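/- **Setting.** Let $L^2=L^2(\mathbb T,m)$ with $m$ normalized Lebesgue measure on the unit circle, $\langle\cdot,\cdot\rangle$ its inner product (linear in the first variable), $H^2$ the Hardy space, and for an inner function $\alpha$ let $K_\alpha=H^2\ominus\alpha H^2$, $K_\alpha^\infty=K_\alpha\cap L^\infty$, $P_\alpha$ the orthogonal projection of $L^2$ onto $K_\alpha$, $S_\alpha f=P_\alpha(zf)$ ($f\in K_\alpha$), $k_{0,n}^\alpha=P_\alpha(n!\,z^n)$ (so that $\langle f,k^\alpha_{0,n}\rangle=f^{(n)}(0)$ for $f\in K_\alpha$), $k_0^\alpha=k_{0,0}^\alpha$, and $\widetilde k_{0,n}^\alpha=C_\alpha k_{0,n}^\alpha$, where $C_\alpha f=\alpha\bar z\bar f$. Write $(f\otimes g)h=\langle h,g\rangle f$. For a positive integer $k$ let $W_k$ be the bounded operator on $L^2$ with $W_k(z^{n})=z^{n/k}$ if $k\mid n$ and $W_k(z^n)=0$ otherwise; thus $(W_k^*f)(z)=f(z^k)$. For $\varphi\in L^2$ put $U_\varphi^{\alpha,\beta}f=P_\beta W_k(\varphi f)$, $f\in K_\alpha^\infty$, and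 let $\mathcal S_k(\alpha,\beta)$ be the set of all $U_\varphi^{\alpha,\beta}$, $\varphi\in L^2$, that extend boundedly to $K_\alpha$ (each identified with its bounded extension $K_\alpha\to K_\beta$). **Theorem.** Let $\alpha,\beta,\gamma$ be nonconstant inner functions and let $k,m$ be positive integers with $k\le\dim K_\alpha$ and $m\le\dim K_\beta$. Let $A=U^{\beta,\gamma}_{\overline{\varphi}_-+\varphi_+}\in\mathcal S_m(\beta,\gamma)$ with $\varphi_-\in K_\beta$, $\varphi_+\in zK_{W_m^*\gamma}$, and $B=U^{\alpha,\beta}_{\overline{\psi}_-+\psi_+}\in\mathcal S_k(\alpha,\beta)$ with $\psi_-\in K_\alpha$, $\psi_+\in zK_{W_k^*\beta}$. Put $$G_j=S_\gamma P_\gamma W_m(\bar z^{\,m-j}\varphi_+)\quad(0\le j<m),\qquad F_{n,l}=S_\beta^{n+1}P_\beta W_k(\bar z^{\,k-l}\psi_+)\quad(0\le n<m,\ 0\le l<k).$$ Then $AB\in\mathcal S_{km}(\alpha,\gamma)$ if and only if there exist $\upsilon\in K_\alpha$ and $\tau_0,\dots,\tau_{km-1}\in K_\gamma$ such that $$\begin{aligned}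 &\sum_{n=0}^{m-1}\tfrac1{n!}(Ak_{0,n}^\beta)\otimes(S_\alpha^{kn}\psi_-)-\sum_{j=0}^{m-1}\left(\tfrac1{j!}\right)^2(S_\gamma A\widetilde k_{0,j}^\beta)\otimes(S_\alpha^{km}B^*\widetilde k_{0,j}^\beta)\\ &\quad+\sum_{j=0}^{m-1}\tfrac1{j!}\,G_j\otimes\Big(B^*k_{0,j}^\beta-\sum_{n=0}^{m-1}\overline{\langle S_\beta^nk_0^\beta,k_{0,j}^\beta\rangle}\,S_\alpha^{kn}\psi_-\Big) =k_0^\gamma\otimes\upsilon+\sum_{p=0}^{km-1}\tau_p\otimes k_{0,p}^\alpha . \end{aligned}$$ Moreover, for all $\upsilon\in K_\alpha$ and $\tau_p\in K_\gamma$ satisfying this identity, $AB=U_\xi^{\alpha,\gamma}$ (with respect to $W_{km}$), where $$\begin{aligned} \xi={}&\overline{\upsilon}+\overline{B^*\varphi_-}-\sum_{n=0}^{m-1}\langle S_\beta^nk_0^\beta,\varphi_-\rangle\,\overline{S_\alpha^{kn}\psi_-}-\sum_{n=0}^{m-1}\sum_{l=0}^{k-1}\tfrac1{l!}\langle F_{n,l},\varphi_-\rangle\,\overline{S_\alpha^{kn}k_{0,l}^\alpha}\\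 &+\sum_{p=0}^{km-1}p!\,(W_{km}^*\tau_p)\,\bar z^{\,p}+\sum_{n=0}^{m-1}\sum_{l=0}^{k-1}W_{km}^*\Big(AF_{n,l}-\sum_{j=0}^{m-1}\tfrac1{j!}\langle F_{n,l},k_{0,j}^\beta\rangle\,G_j\Big)\bar z^{\,kn+l}. \end{aligned}$$ -/

import Mathlib

namespace SlantToeplitz

open MeasureTheory AddCircle ContinuousLinearMap InnerProductSpace
open scoped ENNReal

/-! ### The spaces `L²(𝕋)`, `L^∞(𝕋)`, `H²` -/

/-- Positivity of the circumference of the unit circle. -/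
instance fact_two_pi_pos : Fact (0 < 2 * Real.pi) := ⟨Real.two_pi_pos⟩

/-- The unit circle, parametrized by the angle modulo `2 * π`.  The monomial `z ^ n` is the function
`fourier n`, that is `θ ↦ exp (i n θ)`. -/
abbrev Torus : Type := AddCircle (2 * Real.pi)

/-- Normalized Lebesgue measure on the circle. -/
noncomputable abbrev leb : Measure Torus := haarAddCircle

/-- `L² = L²(𝕋, m)`. -/
abbrev L2 : Type := Lp ℂ 2 leb

/-- `L^∞ = L^∞(𝕋, m)`. -/
abbrev Linf : Type := Lp ℂ ∞ leb

/-- The monomial `z ^ n`, `n ∈ ℤ`, as an element of `L²`. -/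
noncomputable abbrev zpow (n : ℤ) : L2 := fourierLp 2 n

/-- The inclusion `L^∞ ⊆ L²`. -/
noncomputable def Linf.toL2 (u : Linf) : L2 :=
  ((Lp.memLp u).mono_exponent le_top).toLp u

/-- Pointwise multiplication `(u, f) ↦ u f` of `u ∈ L^∞` and `f ∈ L²`. -/
noncomputable def mulL2 : Linf →L[ℂ] L2 →L[ℂ] L2 :=
  (ContinuousLinearMap.mul ℂ ℂ).holderL leb ∞ 2 2

/-- Multiplication by `z ^ n` on `L²`, where `n` is any integer (`z⁻¹` is the conjugate of `z`). -/
noncomputable def zmul (n : ℤ) : L2 →L[ℂ] L2 := mulL2 (fourierLp ∞ n)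

/-- The Hardy space `H²`: all `f ∈ L²` orthogonal to `z ^ n` for every `n < 0`. -/
noncomputable def hardy : Submodule ℂ L2 :=
  (Submodule.span ℂ {f : L2 | ∃ n : ℤ, n < 0 ∧ f = zpow n})ᗮ

/-! ### Inner functions and model spaces -/

/-- An inner function, given by its boundary values: `α ∈ H^∞ = H² ∩ L^∞` and `|α| = 1` a.e. -/
structure InnerFn where
  toLinf : Linf
  mem_hardy : toLinf.toL2 ∈ hardy
  norm_eq_one : ∀ᵐ x ∂leb, ‖toLinf x‖ = 1

/-- The inner function is not (a.e. equal to) a constant. -/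
def InnerFn.Nonconstant (α : InnerFn) : Prop :=
  ¬ ∃ c : ℂ, ∀ᵐ x ∂leb, α.toLinf x = c

/-- `H² ⊖ u H²` for `u ∈ L^∞`. -/
noncomputable def modelSpaceOf (u : Linf) : Submodule ℂ L2 :=
  hardy ⊓ (hardy.map (mulL2 u : L2 →ₗ[ℂ] L2))ᗮ

/-- The model space `K_α = H² ⊖ α H²`. -/
noncomputable abbrev modelSpace (α : InnerFn) : Submodule ℂ L2 := modelSpaceOf α.toLinf

theorem isClosed_modelSpaceOf (u : Linf) : IsClosed (modelSpaceOf u : Set L2) := by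
  have h : (modelSpaceOf u : Set L2) =
      (hardy : Set L2) ∩ ((hardy.map (mulL2 u : L2 →ₗ[ℂ] L2))ᗮ : Submodule ℂ L2) := rfl
  rw [h]
  exact (Submodule.isClosed_orthogonal _).inter (Submodule.isClosed_orthogonal _)

instance completeSpace_modelSpaceOf (u : Linf) : CompleteSpace (modelSpaceOf u) :=
  (isClosed_modelSpaceOf u).completeSpace_coe

/-- The orthogonal projection `P_α` from `L²` onto `K_α`. -/
noncomputable def proj (α : InnerFn) : L2 →L[ℂ] modelSpace α :=
  (modelSpace α).orthogonalProjectionOnto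

/-- The compressed shift `S_α f = P_α (z f)` on `K_α`. -/
noncomputable def cshift (α : InnerFn) : modelSpace α →L[ℂ] modelSpace α :=
  proj α ∘L zmul 1 ∘L (modelSpace α).subtypeL

/-- The kernel function `k_{0,n}^α = P_α (n! z ^ n)` of the `n`-th derivative at `0`. -/
noncomputable def kernel (α : InnerFn) (n : ℕ) : modelSpace α :=
  proj α ((n.factorial : ℂ) • zpow n)

/-- The reproducing property: `⟨f, k_{0,n}^α⟩` is `n!` times the `n`-th Taylor (= Fourier)
coefficient of `f ∈ K_α`, that is `f⁽ⁿ⁾(0)`. -/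
theorem inner_kernel (α : InnerFn) (n : ℕ) (f : modelSpace α) :
    inner ℂ (kernel α n) f = (n.factorial : ℂ) * fourierCoeff (f : L2) n := by
  rw [kernel, proj, Submodule.inner_orthogonalProjectionOnto_eq_of_mem_right, inner_smul_left,
    ← fourierBasis_repr, HilbertBasis.repr_apply_apply, coe_fourierBasis]
  simp

/-- The conjugation `C_α f = α \bar z \bar f` on `L²`. -/
noncomputable def conjC (α : InnerFn) (f : L2) : L2 := mulL2 α.toLinf (zmul (-1) (star f))

/-! ### The operators `W_k` -/

theorem measurePreserving_nsmul_leb (k : ℕ) [NeZero k] :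
    MeasurePreserving (fun x : Torus => k • x) leb leb := by
  have h := Measure.measurePreserving_zsmul leb (n := (k : ℤ)) (by exact_mod_cast NeZero.ne k)
  simpa using h

/-- The isometry `f(z) ↦ f(z ^ k)` of `L^p`.  On `L²` this is the Hilbert space adjoint `W_k^*`. -/
noncomputable def WStar (k : ℕ) [NeZero k] (p : ℝ≥0∞) [Fact (1 ≤ p)] : Lp ℂ p leb →ₗᵢ[ℂ] Lp ℂ p leb :=
  Lp.compMeasurePreservingₗᵢ ℂ (fun x : Torus => k • x) (measurePreserving_nsmul_leb k)

/-- The bounded operator `W_k` on `L²`, see `W_zpow` for its values on monomials. -/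
noncomputable def W (k : ℕ) [NeZero k] : L2 →L[ℂ] L2 :=
  adjoint (WStar k 2).toContinuousLinearMap

theorem coeFn_zpow (n : ℤ) : ⇑(zpow n) =ᵐ[leb] fourier n := coeFn_fourierLp 2 n

theorem inner_zpow (i j : ℤ) : inner ℂ (zpow i) (zpow j) = if i = j then (1 : ℂ) else 0 :=
  orthonormal_iff_ite.mp orthonormal_fourier i j

theorem L2_ext {f g : L2} (h : ∀ j : ℤ, inner ℂ (zpow j) f = (inner ℂ (zpow j) g : ℂ)) :
    f = g := by
  apply (fourierBasis (T := 2 * Real.pi)).repr.injective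
  ext j
  simpa [HilbertBasis.repr_apply_apply, coe_fourierBasis] using h j

theorem WStar_zpow (k : ℕ) [NeZero k] (n : ℤ) : WStar k 2 (zpow n) = zpow (k * n) := by
  apply Lp.ext
  have h1 := Lp.coeFn_compMeasurePreserving (zpow n) (measurePreserving_nsmul_leb k)
  have h2 := (measurePreserving_nsmul_leb k).quasiMeasurePreserving.ae_eq_comp (coeFn_zpow n)
  refine (h1.trans h2).trans (Filter.EventuallyEq.trans ?_ (coeFn_zpow (k * n)).symm)
  refine Filter.Eventually.of_forall fun x => ?_
  simp only [Function.comp_apply, fourier_apply]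
  congr 2
  simp only [mul_comm (k : ℤ) n, mul_zsmul, natCast_zsmul]

/-- `W_k (z ^ n) = z ^ (n / k)` if `k` divides `n`, and `W_k (z ^ n) = 0` otherwise. -/
theorem W_zpow (k : ℕ) [NeZero k] (n : ℤ) :
    W k (zpow n) = if (k : ℤ) ∣ n then zpow (n / k) else 0 := by
  have hk : (k : ℤ) ≠ 0 := by exact_mod_cast NeZero.ne k
  apply L2_ext
  intro j
  have h : inner ℂ (zpow j) (W k (zpow n)) = (inner ℂ (zpow (k * j)) (zpow n) : ℂ) := by
    rw [W, adjoint_inner_right, ← WStar_zpow]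
    rfl
  rw [h, inner_zpow]
  split_ifs with h1 h2 h2
  · rw [inner_zpow, if_pos]
    rw [← h1, Int.mul_ediv_cancel_left _ hk]
  · exact absurd ⟨j, h1.symm⟩ h2
  · rw [inner_zpow, if_neg]
    rintro rfl
    exact h1 (Int.mul_ediv_cancel' h2)
  · simp

theorem coeFn_mulL2 (u : Linf) (f : L2) : ⇑(mulL2 u f) =ᵐ[leb] fun x => u x * f x :=
  coeFn_holder _ _ _

theorem coeFn_zmul (n : ℤ) (f : L2) : ⇑(zmul n f) =ᵐ[leb] fun x => fourier n x * f x := by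
  filter_upwards [coeFn_mulL2 (fourierLp ∞ n) f, coeFn_fourierLp (T := 2 * Real.pi) ∞ n]
    with x hx hy
  rw [zmul, hx, hy]

theorem coeFn_zmul_star (f : L2) :
    ⇑(zmul (-1) (star f)) =ᵐ[leb] fun x => fourier (-1) x * star (f x) := by
  filter_upwards [coeFn_zmul (-1) (star f), Lp.coeFn_star f] with x hx hy
  rw [hx, hy]; rfl

theorem mem_hardy_iff (f : L2) : f ∈ hardy ↔ ∀ n : ℤ, n < 0 → inner ℂ (zpow n) f = (0 : ℂ) := by
  rw [hardy, Submodule.mem_orthogonal]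
  constructor
  · exact fun h n hn => h _ (Submodule.subset_span ⟨n, hn, rfl⟩)
  · intro h u hu
    induction hu using Submodule.span_induction with
    | mem x hx => obtain ⟨n, hn, rfl⟩ := hx; exact h n hn
    | zero => simp
    | add x y _ _ hx hy => rw [inner_add_left, hx, hy, add_zero]
    | smul a x _ hx => rw [inner_smul_left, hx, mul_zero]

theorem zpow_mem_hardy {n : ℤ} (hn : 0 ≤ n) : zpow n ∈ hardy := by
  rw [mem_hardy_iff]
  intro j hj
  rw [inner_zpow, if_neg (by omega)]

/-- `C_α` maps `K_α` into `K_α`. -/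
theorem conjC_mem (α : InnerFn) {f : L2} (hf : f ∈ modelSpace α) : conjC α f ∈ modelSpace α := by
  obtain ⟨hf1, hf2⟩ := hf
  rw [SetLike.mem_coe, mem_hardy_iff] at hf1
  rw [SetLike.mem_coe, Submodule.mem_orthogonal] at hf2
  refine ⟨?_, ?_⟩
  · rw [SetLike.mem_coe, mem_hardy_iff]
    intro n hn
    have h : (inner ℂ (zpow n) (conjC α f) : ℂ) = inner ℂ f (mulL2 α.toLinf (zpow (-n - 1))) := by
      rw [L2.inner_def, L2.inner_def]
      apply integral_congr_ae
      filter_upwards [coeFn_zpow n, coeFn_zpow (-n - 1), coeFn_zmul_star f,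
        coeFn_mulL2 α.toLinf (zmul (-1) (star f)), coeFn_mulL2 α.toLinf (zpow (-n - 1))]
        with x h1 h2 h3 h4 h5
      rw [conjC, h4, h5, h1, h2, h3]
      simp only [RCLike.inner_apply, ← fourier_neg, sub_eq_add_neg, fourier_add]
      simp only [RCLike.star_def]
      ring
    have h' : (inner ℂ (mulL2 α.toLinf (zpow (-n - 1))) f : ℂ) = 0 :=
      hf2 _ ⟨zpow (-n - 1), zpow_mem_hardy (by omega), rfl⟩
    rw [h, ← inner_conj_symm, h', map_zero]
  · rw [SetLike.mem_coe, Submodule.mem_orthogonal]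
    rintro _ ⟨h, hh, rfl⟩
    rw [SetLike.mem_coe, mem_hardy_iff] at hh
    have h0 : (inner ℂ (mulL2 α.toLinf h) (conjC α f) : ℂ) =
        inner ℂ h (zmul (-1) (star f)) := by
      rw [L2.inner_def, L2.inner_def]
      apply integral_congr_ae
      filter_upwards [coeFn_mulL2 α.toLinf (zmul (-1) (star f)), coeFn_mulL2 α.toLinf h,
        α.norm_eq_one] with x h1 h2 h3
      rw [conjC, h1, h2]
      simp only [RCLike.inner_apply, map_mul]
      have h4 : α.toLinf x * (starRingEnd ℂ) (α.toLinf x) = 1 := by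
        rw [Complex.mul_conj, Complex.normSq_eq_norm_sq, h3]; simp
      linear_combination (zmul (-1) (star f) x * (starRingEnd ℂ) (h x)) * h4
    change (inner ℂ (mulL2 α.toLinf h) (conjC α f) : ℂ) = 0
    rw [h0, ← (fourierBasis (T := 2 * Real.pi)).tsum_inner_mul_inner]
    rw [coe_fourierBasis]
    convert tsum_zero with n
    rcases lt_or_ge n 0 with hn | hn
    · rw [← inner_conj_symm, hh n hn, map_zero, zero_mul]
    · have h1 : (inner ℂ (zpow n) (zmul (-1) (star f)) : ℂ) = inner ℂ f (zpow (-n - 1)) := by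
        rw [L2.inner_def, L2.inner_def]
        apply integral_congr_ae
        filter_upwards [coeFn_zpow n, coeFn_zpow (-n - 1), coeFn_zmul_star f] with x h1 h2 h3
        rw [h1, h2, h3]
        simp only [RCLike.inner_apply, ← fourier_neg, sub_eq_add_neg, fourier_add]
        simp only [RCLike.star_def]
        ring
      rw [h1, ← inner_conj_symm f, hf1 _ (by omega), map_zero, mul_zero]

/-- The conjugate kernel function `C_α k_{0,n}^α`. -/
noncomputable def conjKernel (α : InnerFn) (n : ℕ) : modelSpace α :=
  ⟨conjC α (kernel α n), conjC_mem α (kernel α n).2⟩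

/-! ### Compressions of slant Toeplitz operators -/

/-- `U_φ^{α,β} f = P_β W_k (φ f)` for `φ ∈ L²` and a bounded function `f ∈ K_α`. -/
noncomputable def slantCompression (k : ℕ) [NeZero k] (α β : InnerFn) (φ : L2)
    (f : modelSpace α) (hf : MemLp (f : L2) ∞ leb) : modelSpace β :=
  proj β (W k (mulL2 (hf.toLp (f : L2)) φ))

/-- `U_φ^{α,β}`, defined on the bounded functions of `K_α`, extends boundedly to `K_α`, and the
extension is `U`. -/
def IsSlantCompression (k : ℕ) [NeZero k] (α β : InnerFn) (φ : L2)
    (U : modelSpace α →L[ℂ] modelSpace β) : Prop :=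
  ∀ (f : modelSpace α) (hf : MemLp (f : L2) ∞ leb), U f = slantCompression k α β φ f hf

/-- The class `𝒮_k(α, β)`, each operator being identified with its bounded extension to `K_α`. -/
def slantClass (k : ℕ) [NeZero k] (α β : InnerFn) : Set (modelSpace α →L[ℂ] modelSpace β) :=
  {U | ∃ φ : L2, IsSlantCompression k α β φ U}

/-! ### The product of two compressions -/

/-- `S_β P_β W_k (\bar z ^ (k - j) f) ∈ K_β`. -/
noncomputable def lowerPart (k : ℕ) [NeZero k] (β : InnerFn) (f : L2) (j : ℕ) : modelSpace β :=
  cshift β (proj β (W k (zmul ((j : ℤ) - k) f)))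

/-- The identity of operators from `K_α` to `K_γ`
`∑ₙ 1/n! (A k_{0,n}^β) ⊗ (S_α^{kn} ψ₋) - ∑ⱼ (1/j!)² (S_γ A k̃_{0,j}^β) ⊗ (S_α^{km} B* k̃_{0,j}^β)`
`+ ∑ⱼ 1/j! (S_γ P_γ W_m (\bar z ^ (m - j) φ₊)) ⊗ (B* k_{0,j}^β - ∑ₙ conj ⟨S_β^n k_0^β, k_{0,j}^β⟩ S_α^{kn} ψ₋)`
`= k_0^γ ⊗ υ + ∑ₚ τ_p ⊗ k_{0,p}^α`,
where `0 ≤ n, j < m`, `0 ≤ p < km`, and `(f ⊗ g) h = ⟨h, g⟩ f`.  (The inner product `⟨f, g⟩`, linear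
in the first variable, is `inner ℂ g f`.) -/
def ProductCondition (k m : ℕ) [NeZero k] [NeZero m] {α β γ : InnerFn}
    (A : modelSpace β →L[ℂ] modelSpace γ) (B : modelSpace α →L[ℂ] modelSpace β)
    (φpos : L2) (ψneg : modelSpace α)
    (υ : modelSpace α) (τ : Fin (k * m) → modelSpace γ) : Prop :=
  ∑ n ∈ Finset.range m, (1 / (n.factorial : ℂ)) •
      rankOne ℂ (A (kernel β n)) ((cshift α ^ (k * n)) ψneg)
    - ∑ j ∈ Finset.range m, (1 / (j.factorial : ℂ)) ^ 2 •
      rankOne ℂ (cshift γ (A (conjKernel β j)))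
        ((cshift α ^ (k * m)) (adjoint B (conjKernel β j)))
    + ∑ j ∈ Finset.range m, (1 / (j.factorial : ℂ)) •
      rankOne ℂ (lowerPart m γ φpos j)
        (adjoint B (kernel β j) - ∑ n ∈ Finset.range m,
          (starRingEnd ℂ) (inner ℂ (kernel β j) ((cshift β ^ n) (kernel β 0))) •
            (cshift α ^ (k * n)) ψneg)
  = rankOne ℂ (kernel γ 0) υ + ∑ p : Fin (k * m), rankOne ℂ (τ p) (kernel α p)

/-- The function
`\bar υ + conj (B* φ₋) - ∑ₙ ⟨S_β^n k_0^β, φ₋⟩ conj (S_α^{kn} ψ₋)`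
`- ∑ₙ ∑ₗ 1/l! ⟨F_{n,l}, φ₋⟩ conj (S_α^{kn} k_{0,l}^α) + ∑ₚ p! (W_{km}^* τ_p) \bar z ^ p`
`+ ∑ₙ ∑ₗ W_{km}^* (A F_{n,l} - ∑ⱼ 1/j! ⟨F_{n,l}, k_{0,j}^β⟩ S_γ P_γ W_m (\bar z ^ (m - j) φ₊)) \bar z ^ (kn + l)`
with `F_{n,l} = S_β^{n+1} P_β W_k (\bar z ^ (k - l) ψ₊)`,
where `0 ≤ n, j < m`, `0 ≤ l < k`, `0 ≤ p < km`. -/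
noncomputable def productSymbol (k m : ℕ) [NeZero k] [NeZero m] {α β γ : InnerFn}
    (A : modelSpace β →L[ℂ] modelSpace γ) (B : modelSpace α →L[ℂ] modelSpace β)
    (φneg : modelSpace β) (φpos : L2) (ψneg : modelSpace α) (ψpos : L2)
    (υ : modelSpace α) (τ : Fin (k * m) → modelSpace γ) : L2 :=
  let F : ℕ → ℕ → modelSpace β := fun n l => (cshift β ^ n) (lowerPart k β ψpos l)
  star (υ : L2) + star (adjoint B φneg : L2)
    - ∑ n ∈ Finset.range m, (inner ℂ φneg ((cshift β ^ n) (kernel β 0)) : ℂ) •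
        star ((cshift α ^ (k * n)) ψneg : L2)
    - ∑ n ∈ Finset.range m, ∑ l ∈ Finset.range k,
        ((1 / (l.factorial : ℂ)) * inner ℂ φneg (F n l)) •
          star ((cshift α ^ (k * n)) (kernel α l) : L2)
    + ∑ p : Fin (k * m), ((p : ℕ).factorial : ℂ) •
        zmul (-((p : ℕ) : ℤ)) (WStar (k * m) 2 (τ p : L2))
    + ∑ n ∈ Finset.range m, ∑ l ∈ Finset.range k,
        zmul (-((k * n + l : ℕ) : ℤ)) (WStar (k * m) 2
          ((A (F n l) - ∑ j ∈ Finset.range m,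
            ((1 / (j.factorial : ℂ)) * inner ℂ (kernel β j) (F n l)) • lowerPart m γ φpos j :
            modelSpace γ) : L2))

end SlantToeplitz

open SlantToeplitz

namespace SlantToeplitz

open MeasureTheory AddCircle ContinuousLinearMap InnerProductSpace Filter Topology
open scoped ENNReal

/-! ### Multiplication operators and Fourier coefficients -/

/-! The carrier is a displacement characterization of slant compressions: a bounded $U:K_\alpha\to
K_\beta$ lies in $\mathcal S_k(\alpha,\beta)$ iff $U-S_\beta
U(S_\alpha^*)^k=k_0^\beta\otimes\upsilon+\sum_{p<k}\tau_p\otimes k_{0,p}^\alpha$ for some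
$\upsilon,\tau_p$ (`HasDisplacement`). If $U=U_\varphi$, pair with bounded functions: the backward
shifts on the two sides contribute factors $\bar z^k$ that cancel, and only the removed Taylor
coefficients survive (`IsSlantCompression.hasDisplacement`). Conversely, iterate the equation; since
$(S^*)^n\to0$ strongly on both model spaces, the remainder dies and the series sums to the
compression with symbol $\bar\upsilon+\sum_p p!\,\bar z^pW_k^*\tau_p$
(`HasDisplacement.isSlantCompression`).

For the product, evaluate $S_\gamma A(S_\beta^*)^mB$ in two ways. The equation of $A$, applied to
$Bf$, gives $AB$ minus explicit terms. The $m$-fold iterated equation of $B$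
(`HasDisplacement.iterate`) together with $(S_\beta^*)^mS_\beta^m=I-\sum_{j<m}(j!)^{-2}\,\widetilde
k_{0,j}^\beta\otimes\widetilde k_{0,j}^\beta$ (`bshift_pow_cshift_pow`) gives $S_\gamma
AB(S_\alpha^*)^{km}$ plus further terms. Comparing the two (`comp_eq_productLHS_add`), the
displacement of $AB$ is the left-hand side of the product condition plus terms that already have the
form $k_0^\gamma\otimes\cdot$ or $\cdot\otimes k_{0,p}^\alpha$. Hence the condition is exactly the
displacement equation of $AB$ with shifted data, and these shifted data produce $\xi$. -/

theorem zmul_zmul (a b : ℤ) (f : L2) : zmul a (zmul b f) = zmul (a + b) f := by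
  apply Lp.ext
  filter_upwards [coeFn_zmul a (zmul b f), coeFn_zmul b f, coeFn_zmul (a + b) f] with x h1 h2 h3
  rw [h1, h2, h3, fourier_add, mul_assoc]

theorem zmul_zero_apply (f : L2) : zmul 0 f = f := by
  apply Lp.ext
  filter_upwards [coeFn_zmul 0 f] with x h
  rw [h, fourier_zero, one_mul]

theorem zmul_zpow (a b : ℤ) : zmul a (zpow b) = zpow (a + b) := by
  apply Lp.ext
  filter_upwards [coeFn_zmul a (zpow b), coeFn_zpow b, coeFn_zpow (a + b)] with x h1 h2 h3
  rw [h1, h2, h3, fourier_add]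

theorem inner_zmul (n : ℤ) (f g : L2) :
    (inner ℂ (zmul n f) g : ℂ) = inner ℂ f (zmul (-n) g) := by
  rw [L2.inner_def, L2.inner_def]
  apply integral_congr_ae
  filter_upwards [coeFn_zmul n f, coeFn_zmul (-n) g] with x h1 h2
  rw [h1, h2]
  simp only [RCLike.inner_apply, fourier_neg, map_mul]
  ring

theorem inner_zmul_right (n : ℤ) (f g : L2) :
    (inner ℂ f (zmul n g) : ℂ) = inner ℂ (zmul (-n) f) g := by
  rw [inner_zmul, neg_neg]

theorem inner_zpow_zmul (j n : ℤ) (f : L2) :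
    (inner ℂ (zpow j) (zmul n f) : ℂ) = inner ℂ (zpow (j - n)) f := by
  rw [inner_zmul_right, zmul_zpow]
  congr 2
  ring

theorem norm_zmul (n : ℤ) (f : L2) : ‖zmul n f‖ = ‖f‖ := by
  have h : (inner ℂ (zmul n f) (zmul n f) : ℂ) = inner ℂ f f := by
    rw [inner_zmul, zmul_zmul, neg_add_cancel, zmul_zero_apply]
  rw [inner_self_eq_norm_sq_to_K, inner_self_eq_norm_sq_to_K] at h
  have h' : ‖zmul n f‖ ^ 2 = ‖f‖ ^ 2 := by exact_mod_cast h
  exact (sq_eq_sq₀ (norm_nonneg _) (norm_nonneg _)).mp h'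

theorem mulL2_zmul (u : Linf) (n : ℤ) (f : L2) : mulL2 u (zmul n f) = zmul n (mulL2 u f) := by
  apply Lp.ext
  filter_upwards [coeFn_zmul n f, coeFn_zmul n (mulL2 u f), coeFn_mulL2 u f,
    coeFn_mulL2 u (zmul n f)] with x h1 h2 h3 h4
  rw [h4, h1, h2, h3]
  ring

theorem inner_W_right (k : ℕ) [NeZero k] (f g : L2) :
    (inner ℂ f (W k g) : ℂ) = inner ℂ (WStar k 2 f) g := by
  rw [W, adjoint_inner_right]
  rfl

theorem inner_zpow_W (k : ℕ) [NeZero k] (j : ℤ) (f : L2) :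
    (inner ℂ (zpow j) (W k f) : ℂ) = inner ℂ (zpow (k * j)) f := by
  rw [inner_W_right, WStar_zpow]

theorem zmul_W (k : ℕ) [NeZero k] (n : ℤ) (f : L2) : zmul n (W k f) = W k (zmul (k * n) f) := by
  apply L2_ext
  intro j
  rw [inner_zpow_zmul, inner_zpow_W, inner_zpow_W, inner_zpow_zmul]
  congr 2
  ring

theorem inner_star_star (f g : L2) : (inner ℂ (star f) (star g) : ℂ) = inner ℂ g f := by
  rw [L2.inner_def, L2.inner_def]
  apply integral_congr_ae
  filter_upwards [Lp.coeFn_star f, Lp.coeFn_star g] with x h1 h2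
  rw [h1, h2]
  simp [mul_comm]

theorem star_zpow (n : ℤ) : star (zpow n) = zpow (-n) := by
  apply Lp.ext
  filter_upwards [Lp.coeFn_star (zpow n), coeFn_zpow n, coeFn_zpow (-n)] with x h1 h2 h3
  rw [h1, h3, Pi.star_apply, h2, fourier_neg]
  rfl

theorem inner_zpow_star (n : ℤ) (f : L2) :
    (inner ℂ (zpow n) (star f) : ℂ) = inner ℂ f (zpow (-n)) := by
  rw [← inner_star_star, star_star, star_zpow]

theorem hasSum_zpow (f : L2) : HasSum (fun n : ℤ => (inner ℂ (zpow n) f : ℂ) • zpow n) f := by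
  have h := (fourierBasis (T := 2 * Real.pi)).hasSum_repr f
  simpa only [HilbertBasis.repr_apply_apply, coe_fourierBasis] using h

/-! ### The Hardy space -/

theorem hasSum_hardy {f : L2} (hf : f ∈ hardy) :
    HasSum (fun n : ℕ => (inner ℂ (zpow n) f : ℂ) • zpow n) f := by
  have hi : Function.Injective (fun n : ℕ => (n : ℤ)) := fun a b h => Int.ofNat.inj h
  refine (hi.hasSum_iff (f := fun n : ℤ => (inner ℂ (zpow n) f : ℂ) • zpow n) ?_).mpr
    (hasSum_zpow f)
  intro n hn
  rw [(mem_hardy_iff f).mp hf n, zero_smul]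
  by_contra h
  exact hn ⟨n.toNat, by simp only; omega⟩

theorem tendsto_partialSum {f : L2} (hf : f ∈ hardy) :
    Tendsto (fun N : ℕ => ∑ n ∈ Finset.range N, (inner ℂ (zpow n) f : ℂ) • zpow n) atTop (𝓝 f) :=
  (hasSum_hardy hf).tendsto_sum_nat

theorem map_eq_zero_of_mem_hardy {F : Type*} [NormedAddCommGroup F] [NormedSpace ℂ F]
    (L : L2 →L[ℂ] F) (hL : ∀ n : ℕ, L (zpow n) = 0) {f : L2} (hf : f ∈ hardy) : L f = 0 := by
  have h := (hasSum_hardy hf).mapL L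
  simp only [map_smul, hL, smul_zero] at h
  exact h.unique hasSum_zero

theorem zmul_mem_hardy {n : ℤ} (hn : 0 ≤ n) {f : L2} (hf : f ∈ hardy) : zmul n f ∈ hardy := by
  rw [mem_hardy_iff] at hf ⊢
  intro j hj
  rw [inner_zpow_zmul, hf _ (by omega)]

theorem inner_eq_zero_of_coeff {f g : L2} (hg : g ∈ hardy)
    (hf : ∀ n : ℕ, (inner ℂ (zpow n) f : ℂ) = 0) : (inner ℂ f g : ℂ) = 0 := by
  refine map_eq_zero_of_mem_hardy (innerSL ℂ f) (fun n => ?_) hg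
  rw [innerSL_apply_apply, ← inner_conj_symm, hf, map_zero]

theorem ext_of_mem_hardy {f g : L2} (hf : f ∈ hardy) (hg : g ∈ hardy)
    (h : ∀ n : ℕ, (inner ℂ (zpow n) f : ℂ) = inner ℂ (zpow n) g) : f = g := by
  apply L2_ext
  intro j
  rcases lt_or_ge j 0 with hj | hj
  · rw [(mem_hardy_iff f).mp hf j hj, (mem_hardy_iff g).mp hg j hj]
  · lift j to ℕ using hj
    exact h j

theorem mulL2_toLinf_zpow_zero (u : Linf) : mulL2 u (zpow 0) = u.toL2 := by
  apply Lp.ext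
  filter_upwards [coeFn_mulL2 u (zpow 0), coeFn_zpow 0,
    ((Lp.memLp u).mono_exponent (q := ∞) (p := 2) le_top).coeFn_toLp] with x h1 h2 h3
  rw [h1, h2, fourier_zero, mul_one, Linf.toL2, h3]

theorem mulL2_zpow (u : Linf) (n : ℤ) : mulL2 u (zpow n) = zmul n u.toL2 := by
  rw [← mulL2_toLinf_zpow_zero, ← mulL2_zmul, zmul_zpow, add_zero]

theorem inner_mulL2_mulL2 (α : InnerFn) (f g : L2) :
    (inner ℂ (mulL2 α.toLinf f) (mulL2 α.toLinf g) : ℂ) = inner ℂ f g := by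
  rw [L2.inner_def, L2.inner_def]
  apply integral_congr_ae
  filter_upwards [coeFn_mulL2 α.toLinf f, coeFn_mulL2 α.toLinf g, α.norm_eq_one] with x h1 h2 h3
  rw [h1, h2]
  simp only [RCLike.inner_apply, map_mul]
  have h4 : α.toLinf x * (starRingEnd ℂ) (α.toLinf x) = 1 := by
    rw [Complex.mul_conj, Complex.normSq_eq_norm_sq, h3]; simp
  linear_combination (g x * (starRingEnd ℂ) (f x)) * h4

theorem mulL2_mem_hardy (α : InnerFn) {f : L2} (hf : f ∈ hardy) :
    mulL2 α.toLinf f ∈ hardy := by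
  rw [mem_hardy_iff]
  intro n hn
  refine map_eq_zero_of_mem_hardy (innerSL ℂ (zpow n) ∘L mulL2 α.toLinf) (fun j => ?_) hf
  rw [comp_apply, innerSL_apply_apply, mulL2_zpow, inner_zpow_zmul]
  exact (mem_hardy_iff _).mp α.mem_hardy _ (by omega)

/-! ### Model spaces -/

/-- By continuity, orthogonality to $\alpha H^2$ need only be tested on the functions $\alpha z^n$,
$n\ge0$. -/
theorem mem_modelSpace_iff (α : InnerFn) (f : L2) : f ∈ modelSpace α ↔
    f ∈ hardy ∧ ∀ n : ℕ, (inner ℂ (mulL2 α.toLinf (zpow n)) f : ℂ) = 0 := by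
  rw [modelSpace, modelSpaceOf, Submodule.mem_inf, Submodule.mem_orthogonal]
  refine and_congr_right fun _ => ⟨fun h n => ?_, ?_⟩
  · exact h _ ⟨zpow n, zpow_mem_hardy (by omega), rfl⟩
  · rintro h _ ⟨g, hg, rfl⟩
    rw [← inner_conj_symm]
    refine (map_eq_zero _).mpr (map_eq_zero_of_mem_hardy (innerSL ℂ f ∘L mulL2 α.toLinf)
      (fun n => ?_) hg)
    rw [comp_apply, innerSL_apply_apply, ← inner_conj_symm, h, map_zero]

theorem coe_mem_hardy {α : InnerFn} (f : modelSpace α) : (f : L2) ∈ hardy :=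
  ((mem_modelSpace_iff α f).mp f.2).1

theorem inner_mulL2_coe {α : InnerFn} (f : modelSpace α) {h : L2} (hh : h ∈ hardy) :
    (inner ℂ (mulL2 α.toLinf h) (f : L2) : ℂ) = 0 :=
  (Submodule.mem_orthogonal _ _).mp f.2.2 _ ⟨h, hh, rfl⟩

theorem inner_proj_right (α : InnerFn) (f : modelSpace α) (h : L2) :
    (inner ℂ f (proj α h) : ℂ) = inner ℂ (f : L2) h :=
  Submodule.inner_orthogonalProjectionOnto_eq_of_mem_left _ _

theorem inner_proj_left (α : InnerFn) (f : modelSpace α) (h : L2) :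
    (inner ℂ (proj α h) f : ℂ) = inner ℂ h (f : L2) :=
  Submodule.inner_orthogonalProjectionOnto_eq_of_mem_right _ _

theorem inner_smul_coe {α : InnerFn} (c : ℂ) (f g : modelSpace α) :
    (inner ℂ f (c • g) : ℂ) = c * inner ℂ f g := inner_smul_right f g c

theorem inner_smul_coe_left {α : InnerFn} (c : ℂ) (f g : modelSpace α) :
    (inner ℂ (c • f) g : ℂ) = (starRingEnd ℂ) c * inner ℂ f g := inner_smul_left f g c

theorem proj_coe {α : InnerFn} (f : modelSpace α) : proj α (f : L2) = f :=
  Submodule.orthogonalProjectionOnto_mem_subspace_eq_self f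

theorem proj_eq_of_sub {α : InnerFn} (f : modelSpace α) {h : L2}
    (hh : ∀ g : modelSpace α, (inner ℂ (g : L2) (h - f) : ℂ) = 0) : proj α h = f := by
  refine ext_inner_left ℂ fun g => ?_
  have := hh g
  rw [inner_sub_right, sub_eq_zero] at this
  rw [inner_proj_right, this]
  rfl

theorem proj_eq_zero_of_coeff (α : InnerFn) {h : L2}
    (hh : ∀ n : ℕ, (inner ℂ (zpow n) h : ℂ) = 0) : proj α h = 0 := by
  refine ext_inner_left ℂ fun g => ?_
  rw [inner_proj_right, inner_zero_right, ← inner_conj_symm,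
    inner_eq_zero_of_coeff (coe_mem_hardy g) hh, map_zero]

theorem inner_kernel_left {α : InnerFn} (n : ℕ) (f : modelSpace α) :
    (inner ℂ (kernel α n) f : ℂ) = n.factorial * inner ℂ (zpow n) (f : L2) := by
  rw [kernel, inner_proj_left, inner_smul_left]
  simp

theorem inner_kernel_zero_right {α : InnerFn} (f : modelSpace α) :
    (inner ℂ f (kernel α 0) : ℂ) = inner ℂ (f : L2) (zpow 0) := by
  rw [kernel, inner_proj_right]
  simp

/-! ### The compressed shift and its adjoint -/

theorem zmul_neg_one_sub_mem {α : InnerFn} (f : modelSpace α) :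
    zmul (-1) (f : L2) - (inner ℂ (zpow 0) (f : L2) : ℂ) • zpow (-1) ∈ modelSpace α := by
  rw [mem_modelSpace_iff]
  constructor
  · rw [mem_hardy_iff]
    intro n hn
    rw [inner_sub_right, inner_smul_right, inner_zpow, inner_zpow_zmul]
    rcases eq_or_ne n (-1) with rfl | h
    · simp
    · rw [if_neg h, (mem_hardy_iff _).mp (coe_mem_hardy f) _ (by omega), mul_zero, sub_zero]
  · intro n
    rw [inner_sub_right, inner_smul_right, inner_zmul_right, neg_neg, ← mulL2_zmul, zmul_zpow,
      inner_mulL2_coe f (zpow_mem_hardy (by omega)), ← inner_conj_symm _ (zpow (-1)),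
      (mem_hardy_iff _).mp (mulL2_mem_hardy α (zpow_mem_hardy (by omega))) _ (by omega)]
    simp

/-- The adjoint of the compressed shift, that is, the backward shift on `K_α`. -/
noncomputable abbrev bshift (α : InnerFn) : modelSpace α →L[ℂ] modelSpace α := adjoint (cshift α)

theorem coe_bshift {α : InnerFn} (f : modelSpace α) :
    ((bshift α f : modelSpace α) : L2) =
      zmul (-1) (f : L2) - (inner ℂ (zpow 0) (f : L2) : ℂ) • zpow (-1) := by
  suffices h : bshift α f = ⟨_, zmul_neg_one_sub_mem f⟩ by rw [h]
  refine ext_inner_left ℂ fun g => ?_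
  rw [adjoint_inner_right, cshift, comp_apply, inner_proj_left, comp_apply, inner_zmul,
    Submodule.coe_inner, inner_sub_right, inner_smul_right, ← inner_conj_symm _ (zpow (-1)),
    (mem_hardy_iff _).mp (coe_mem_hardy g) _ (by omega)]
  simp

/-- The correction term appears because multiplication by $z$ moves the coefficient of $\bar z$,
invisible to $P_\alpha$, into the constant term. -/
theorem cshift_proj (α : InnerFn) (h : L2) :
    cshift α (proj α h) = proj α (zmul 1 h) - (inner ℂ (zpow (-1)) h : ℂ) • kernel α 0 := by
  refine ext_inner_left ℂ fun g => ?_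
  rw [← adjoint_inner_left, inner_proj_right, coe_bshift, inner_sub_left, inner_zmul,
    inner_sub_right, inner_proj_right, inner_smul_left, inner_conj_symm, neg_neg]
  rw [inner_smul_coe, inner_kernel_zero_right]
  ring

theorem cshift_proj_of_mem_hardy (α : InnerFn) {h : L2} (hh : h ∈ hardy) :
    cshift α (proj α h) = proj α (zmul 1 h) := by
  rw [cshift_proj, (mem_hardy_iff _).mp hh _ (by omega), zero_smul, sub_zero]

theorem pow_succ_apply' {M : Type*} [NormedAddCommGroup M] [NormedSpace ℂ M] (T : M →L[ℂ] M)
    (n : ℕ) (x : M) : (T ^ (n + 1)) x = T ((T ^ n) x) := by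
  rw [pow_succ']
  rfl

theorem cshift_pow_proj_of_mem_hardy (α : InnerFn) {h : L2} (hh : h ∈ hardy) (n : ℕ) :
    (cshift α ^ n) (proj α h) = proj α (zmul n h) := by
  induction n with
  | zero => simp [zmul_zero_apply]
  | succ n ih =>
    rw [pow_succ_apply', ih, cshift_proj_of_mem_hardy α (zmul_mem_hardy (by omega) hh),
      zmul_zmul, Nat.cast_succ, add_comm (1 : ℤ)]

theorem cshift_pow_kernel (α : InnerFn) (n l : ℕ) :
    (cshift α ^ n) (kernel α l) =
      ((l.factorial : ℂ) / ((n + l).factorial : ℂ)) • kernel α (n + l) := by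
  have h : ((n + l).factorial : ℂ) ≠ 0 := by exact_mod_cast (n + l).factorial_ne_zero
  rw [kernel, kernel, map_smul, map_smul, cshift_pow_proj_of_mem_hardy α (zpow_mem_hardy (by omega)),
    zmul_zpow, map_smul, smul_smul, div_mul_cancel₀ _ h]
  push_cast
  rfl

/-- Each backward shift removes the current constant term, so $n$ of them remove the first $n$
Taylor coefficients. -/
theorem coe_bshift_pow {α : InnerFn} (n : ℕ) (f : modelSpace α) :
    (((bshift α ^ n) f : modelSpace α) : L2) =
      zmul (-n) ((f : L2) - ∑ j ∈ Finset.range n, (inner ℂ (zpow j) (f : L2) : ℂ) • zpow j) := by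
  induction n with
  | zero => simp [zmul_zero_apply]
  | succ n ih =>
    have h0 : (inner ℂ (zpow 0) (zmul (-n) ((f : L2) - ∑ j ∈ Finset.range n,
        (inner ℂ (zpow j) (f : L2) : ℂ) • zpow j)) : ℂ) = inner ℂ (zpow n) (f : L2) := by
      rw [inner_zpow_zmul, inner_sub_right, inner_sum, Finset.sum_eq_zero, sub_zero]
      · congr 2; ring_nf
      · intro j hj
        rw [inner_smul_right, inner_zpow, if_neg, mul_zero]
        have := Finset.mem_range.mp hj
        omega
    rw [pow_succ_apply', coe_bshift, ih, h0, zmul_zmul, Finset.sum_range_succ,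
      ← sub_sub, map_sub _ _ ((inner ℂ (zpow n) (f : L2) : ℂ) • zpow n), map_smul, zmul_zpow]
    push_cast
    congr 3 <;> ring_nf

theorem inner_zpow_bshift_pow {α : InnerFn} (n j : ℕ) (f : modelSpace α) :
    (inner ℂ (zpow j) (((bshift α ^ n) f : modelSpace α) : L2) : ℂ) =
      inner ℂ (zpow (n + j)) (f : L2) := by
  rw [coe_bshift_pow, inner_zpow_zmul, inner_sub_right, inner_sum, Finset.sum_eq_zero,
    sub_zero]
  · congr 2; ring_nf
  · intro i hi
    rw [inner_smul_right, inner_zpow, if_neg, mul_zero]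
    have := Finset.mem_range.mp hi
    omega

/-- The Taylor polynomial removed from $g$ lands on negative frequencies after multiplication by
$\bar z^n$, hence is orthogonal to $f$. -/
theorem inner_bshift_pow_right {α : InnerFn} (n : ℕ) (f g : modelSpace α) :
    (inner ℂ f ((bshift α ^ n) g) : ℂ) = inner ℂ (zmul n (f : L2)) (g : L2) := by
  have h : (inner ℂ (f : L2) (zmul (-n) (∑ j ∈ Finset.range n,
      (inner ℂ (zpow j) (g : L2) : ℂ) • zpow j)) : ℂ) = 0 := by
    rw [map_sum, inner_sum]
    refine Finset.sum_eq_zero fun j hj => ?_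
    have := Finset.mem_range.mp hj
    rw [map_smul, inner_smul_right, zmul_zpow, ← inner_conj_symm _ (zpow _),
      (mem_hardy_iff _).mp (coe_mem_hardy f) _ (by omega), map_zero, mul_zero]
  rw [Submodule.coe_inner, coe_bshift_pow, map_sub, inner_sub_right, h, sub_zero,
    inner_zmul]

theorem adjoint_pow_cshift (α : InnerFn) (n : ℕ) :
    adjoint (cshift α ^ n) = bshift α ^ n := by
  rw [← star_eq_adjoint, star_pow, star_eq_adjoint]

/-- The norm of $(S_\alpha^*)^nf$ is the norm of a tail of the Fourier series of $f$. -/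
theorem tendsto_bshift_pow {α : InnerFn} (f : modelSpace α) :
    Tendsto (fun n : ℕ => (bshift α ^ n) f) atTop (𝓝 0) := by
  rw [tendsto_zero_iff_norm_tendsto_zero]
  have h := (tendsto_const_nhds (x := (f : L2))).sub (tendsto_partialSum (coe_mem_hardy f))
  rw [sub_self, tendsto_zero_iff_norm_tendsto_zero] at h
  refine h.congr fun n => ?_
  rw [Submodule.coe_norm, coe_bshift_pow, norm_zmul]

/-- Among the orthonormal functions $\alpha z^n$ only $\alpha$ itself can meet $h$, so only that
component is subtracted. The cases $h=zf$ and $h=1$ give formulas for $S_\alpha f$ and $k_0^\alpha$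
from which boundedness can be read off. -/
theorem coe_proj_eq_sub {α : InnerFn} {h : L2} (hh : h ∈ hardy)
    (hα : ∀ n : ℕ, (inner ℂ (mulL2 α.toLinf (zpow (n + 1))) h : ℂ) = 0) :
    (proj α h : L2) = h - (inner ℂ α.toLinf.toL2 h : ℂ) • α.toLinf.toL2 := by
  have hmem : h - (inner ℂ α.toLinf.toL2 h : ℂ) • α.toLinf.toL2 ∈ modelSpace α := by
    rw [mem_modelSpace_iff]
    refine ⟨Submodule.sub_mem _ hh (Submodule.smul_mem _ _ α.mem_hardy), fun n => ?_⟩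
    rw [← mulL2_toLinf_zpow_zero, inner_sub_right, inner_smul_right, inner_mulL2_mulL2, inner_zpow]
    rcases n with _ | n
    · simp
    · rw [Nat.cast_succ, hα, if_neg (by omega), mul_zero, sub_zero]
  have h : proj α h = ⟨_, hmem⟩ := by
    refine proj_eq_of_sub (α := α) _ fun g => ?_
    rw [← inner_conj_symm]
    refine (map_eq_zero _).mpr ?_
    rw [sub_sub_cancel, inner_smul_left, ← mulL2_toLinf_zpow_zero,
      inner_mulL2_coe g (zpow_mem_hardy le_rfl), mul_zero]
  rw [h]

theorem coe_cshift {α : InnerFn} (f : modelSpace α) : ((cshift α f : modelSpace α) : L2) =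
    zmul 1 (f : L2) - (inner ℂ α.toLinf.toL2 (zmul 1 (f : L2)) : ℂ) • α.toLinf.toL2 := by
  refine coe_proj_eq_sub (zmul_mem_hardy (by omega) (coe_mem_hardy f)) fun n => ?_
  change (inner ℂ (mulL2 α.toLinf (zpow (n + 1))) (zmul 1 (f : L2)) : ℂ) = 0
  rw [inner_zmul_right, ← mulL2_zmul, zmul_zpow, inner_mulL2_coe f (zpow_mem_hardy (by omega))]

theorem coe_kernel_zero (α : InnerFn) : (kernel α 0 : L2) =
    zpow 0 - (inner ℂ α.toLinf.toL2 (zpow 0) : ℂ) • α.toLinf.toL2 := by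
  rw [kernel, Nat.factorial_zero, Nat.cast_one, one_smul]
  refine coe_proj_eq_sub (zpow_mem_hardy le_rfl) fun n => ?_
  rw [← inner_conj_symm, mulL2_zpow, inner_zpow_zmul, (mem_hardy_iff _).mp α.mem_hardy _ (by omega),
    map_zero]

/-! ### Bounded functions -/

theorem memLp_top_zpow (n : ℤ) : MemLp (zpow n) ∞ leb :=
  (Lp.memLp (fourierLp (T := 2 * Real.pi) ∞ n)).ae_eq
    ((coeFn_fourierLp ∞ n).trans (coeFn_zpow n).symm)

theorem memLp_top_toL2 (u : Linf) : MemLp u.toL2 ∞ leb :=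
  (Lp.memLp u).ae_eq (((Lp.memLp u).mono_exponent le_top).coeFn_toLp).symm

theorem memLp_top_zmul {f : L2} (hf : MemLp f ∞ leb) (n : ℤ) : MemLp (zmul n f) ∞ leb := by
  have h : MemLp (fun x => fourier n x * f x) ∞ leb :=
    MemLp.mul hf ((memLp_top_zpow n).ae_eq (coeFn_zpow n))
  exact h.ae_eq (coeFn_zmul n f).symm

theorem memLp_top_sub {f g : L2} (hf : MemLp f ∞ leb) (hg : MemLp g ∞ leb) :
    MemLp (f - g : L2) ∞ leb :=
  (hf.sub hg).ae_eq (Lp.coeFn_sub f g).symm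

theorem memLp_top_smul {f : L2} (hf : MemLp f ∞ leb) (c : ℂ) : MemLp (c • f : L2) ∞ leb :=
  (hf.const_smul c).ae_eq (Lp.coeFn_smul c f).symm

theorem memLp_top_WStar {f : L2} (hf : MemLp f ∞ leb) (k : ℕ) [NeZero k] :
    MemLp (WStar k 2 f) ∞ leb :=
  (hf.comp_measurePreserving (measurePreserving_nsmul_leb k)).ae_eq
    (Lp.coeFn_compMeasurePreserving f (measurePreserving_nsmul_leb k)).symm

theorem memLp_top_cshift {α : InnerFn} {f : modelSpace α} (hf : MemLp (f : L2) ∞ leb) :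
    MemLp (cshift α f : L2) ∞ leb := by
  rw [coe_cshift]
  exact memLp_top_sub (memLp_top_zmul hf 1) (memLp_top_smul (memLp_top_toL2 _) _)

theorem memLp_top_bshift {α : InnerFn} {f : modelSpace α} (hf : MemLp (f : L2) ∞ leb) :
    MemLp (bshift α f : L2) ∞ leb := by
  rw [coe_bshift]
  exact memLp_top_sub (memLp_top_zmul hf _) (memLp_top_smul (memLp_top_zpow _) _)

theorem memLp_top_bshift_pow {α : InnerFn} {f : modelSpace α} (hf : MemLp (f : L2) ∞ leb)
    (n : ℕ) : MemLp ((bshift α ^ n) f : L2) ∞ leb := by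
  induction n with
  | zero => exact hf
  | succ n ih => rw [pow_succ_apply']; exact memLp_top_bshift ih

theorem memLp_top_cshift_pow {α : InnerFn} {f : modelSpace α} (hf : MemLp (f : L2) ∞ leb)
    (n : ℕ) : MemLp ((cshift α ^ n) f : L2) ∞ leb := by
  induction n with
  | zero => exact hf
  | succ n ih => rw [pow_succ_apply']; exact memLp_top_cshift ih

theorem kernel_eq_smul (α : InnerFn) (n : ℕ) :
    kernel α n = (n.factorial : ℂ) • (cshift α ^ n) (kernel α 0) := by
  have h : (n.factorial : ℂ) ≠ 0 := by exact_mod_cast n.factorial_ne_zero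
  rw [cshift_pow_kernel, smul_smul, Nat.add_zero, Nat.factorial_zero, Nat.cast_one,
    mul_one_div_cancel h, one_smul]

theorem memLp_top_kernel (α : InnerFn) (n : ℕ) : MemLp (kernel α n : L2) ∞ leb := by
  rw [kernel_eq_smul]
  refine memLp_top_smul (memLp_top_cshift_pow ?_ n) _
  rw [coe_kernel_zero]
  exact memLp_top_sub (memLp_top_zpow 0) (memLp_top_smul (memLp_top_toL2 _) _)

/-- The kernels $k_{0,n}^\alpha$ are bounded and recover every Taylor coefficient; this plays the
role of the density of $K_\alpha^\infty$ in $K_\alpha$. -/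
theorem eq_of_inner_bounded {α : InnerFn} {v w : modelSpace α}
    (h : ∀ g : modelSpace α, MemLp (g : L2) ∞ leb → (inner ℂ g v : ℂ) = inner ℂ g w) : v = w := by
  refine Subtype.ext (ext_of_mem_hardy (coe_mem_hardy v) (coe_mem_hardy w) fun n => ?_)
  have h0 : (n.factorial : ℂ) ≠ 0 := by exact_mod_cast n.factorial_ne_zero
  have h1 := h _ (memLp_top_kernel α n)
  rw [inner_kernel_left, inner_kernel_left] at h1
  exact mul_left_cancel₀ h0 h1

theorem clm_ext_of_bounded {α β : InnerFn} {T U : modelSpace α →L[ℂ] modelSpace β}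
    (h : ∀ f : modelSpace α, MemLp (f : L2) ∞ leb → T f = U f) : T = U := by
  -- Passing to adjoints turns the bounded vectors of the domain into test vectors.
  have h1 : adjoint T = adjoint U := by
    ext1 g
    refine eq_of_inner_bounded fun f hf => ?_
    rw [adjoint_inner_right, adjoint_inner_right, h f hf]
  exact (adjoint (𝕜 := ℂ) (E := modelSpace α) (F := modelSpace β)).injective h1

/-- Multiplication by a bounded element of `L²`. -/
noncomputable def bmul {f : L2} (hf : MemLp f ∞ leb) : L2 →L[ℂ] L2 := mulL2 (hf.toLp f)

theorem coeFn_bmul {f : L2} (hf : MemLp f ∞ leb) (φ : L2) :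
    ⇑(bmul hf φ) =ᵐ[leb] fun x => f x * φ x := by
  filter_upwards [coeFn_mulL2 (hf.toLp f) φ, hf.coeFn_toLp] with x h1 h2
  rw [bmul, h1, h2]

theorem slantCompression_eq (k : ℕ) [NeZero k] (α β : InnerFn) (φ : L2) (f : modelSpace α)
    (hf : MemLp (f : L2) ∞ leb) :
    slantCompression k α β φ f hf = proj β (W k (bmul hf φ)) := rfl

theorem inner_bmul_eq_inner_bmul_star {f g : L2} (hf : MemLp f ∞ leb) (hg : MemLp g ∞ leb)
    (φ : L2) : (inner ℂ g (bmul hf φ) : ℂ) = inner ℂ (bmul hg (star φ)) f := by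
  rw [L2.inner_def, L2.inner_def]
  apply integral_congr_ae
  filter_upwards [coeFn_bmul hf φ, coeFn_bmul hg (star φ), Lp.coeFn_star φ] with x h1 h2 h3
  rw [h1, h2, h3]
  simp only [RCLike.inner_apply, Pi.star_apply, map_mul, RCLike.star_def, Complex.conj_conj]
  ring

theorem inner_zmul_eq_inner_bmul_star {f : L2} (hf : MemLp f ∞ leb) (n : ℤ) (υ : L2) :
    (inner ℂ (zmul n υ) f : ℂ) = inner ℂ (zpow n) (bmul hf (star υ)) := by
  rw [L2.inner_def, L2.inner_def]
  apply integral_congr_ae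
  filter_upwards [coeFn_zmul n υ, coeFn_bmul hf (star υ), Lp.coeFn_star υ, coeFn_zpow n]
    with x h1 h2 h3 h4
  rw [h1, h2, h3, h4]
  simp only [RCLike.inner_apply, Pi.star_apply, map_mul, RCLike.star_def]
  ring

theorem inner_bmul_star_zpow {g : L2} (hg : MemLp g ∞ leb) (n : ℤ) (φ : L2) :
    (inner ℂ (bmul hg (star φ)) (zpow n) : ℂ) = inner ℂ g (zmul n φ) := by
  rw [← inner_conj_symm, ← inner_zmul_eq_inner_bmul_star, inner_conj_symm]

theorem coeFn_WStar (k : ℕ) [NeZero k] (f : L2) :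
    ⇑(WStar k 2 f) =ᵐ[leb] fun x => f (k • x) :=
  Lp.coeFn_compMeasurePreserving f (measurePreserving_nsmul_leb k)

theorem WStar_bmul_star (k : ℕ) [NeZero k] {g : L2} (hg : MemLp g ∞ leb) (τ : L2) :
    WStar k 2 (bmul hg (star τ)) = bmul (memLp_top_WStar hg k) (star (WStar k 2 τ)) := by
  apply Lp.ext
  have h := (measurePreserving_nsmul_leb k).quasiMeasurePreserving.ae_eq_comp
    ((coeFn_bmul hg (star τ)).trans (Filter.EventuallyEq.rfl.mul (Lp.coeFn_star τ)))
  filter_upwards [coeFn_WStar k (bmul hg (star τ)), h, coeFn_WStar k g, coeFn_WStar k τ,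
    coeFn_bmul (memLp_top_WStar hg k) (star (WStar k 2 τ)), Lp.coeFn_star (WStar k 2 τ)]
    with x h1 h2 h3 h4 h5 h6
  rw [h1, h5, h3, h6, Pi.star_apply, h4]
  exact h2

theorem zmul_bmul {f : L2} (hf : MemLp f ∞ leb) (n : ℤ) (φ : L2) :
    zmul n (bmul hf φ) = bmul hf (zmul n φ) := (mulL2_zmul _ _ _).symm

/-! ### Displacement equations -/

/-- The identity `U - S_β U (S_α^*)^k = k_0^β ⊗ υ + ∑_{p < k} τ_p ⊗ k_{0,p}^α`. -/
def HasDisplacement (k : ℕ) {α β : InnerFn} (U : modelSpace α →L[ℂ] modelSpace β)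
    (υ : modelSpace α) (τ : ℕ → modelSpace β) : Prop :=
  ∀ f : modelSpace α, U f = cshift β (U ((bshift α ^ k) f)) + (inner ℂ υ f : ℂ) • kernel β 0 +
    ∑ p ∈ Finset.range k, (inner ℂ (kernel α p) f : ℂ) • τ p

/-! ### Necessity: a symbol gives a displacement equation -/

theorem WStar_zmul (k : ℕ) [NeZero k] (n : ℤ) (f : L2) :
    WStar k 2 (zmul n f) = zmul (k * n) (WStar k 2 f) := by
  apply Lp.ext
  have h := (measurePreserving_nsmul_leb k).quasiMeasurePreserving.ae_eq_comp (coeFn_zmul n f)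
  filter_upwards [coeFn_WStar k (zmul n f), h, coeFn_WStar k f, coeFn_zmul (k * n) (WStar k 2 f)]
    with x h1 h2 h3 h4
  rw [h1, h4, h3]
  refine h2.trans ?_
  simp only [Function.comp_apply, fourier_apply]
  congr 3
  simp only [mul_comm (k : ℤ) n, mul_zsmul, natCast_zsmul]

theorem bmul_WStar_bshift {β : InnerFn} (k : ℕ) [NeZero k] {g : modelSpace β}
    (hg : MemLp (g : L2) ∞ leb) (φ : L2) :
    bmul (memLp_top_WStar (memLp_top_bshift hg) k) φ =
      zmul (-k) (bmul (memLp_top_WStar hg k) φ - (inner ℂ (zpow 0) (g : L2) : ℂ) • φ) := by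
  have h0 : WStar k 2 (bshift β g : L2) =
      zmul (-k) (WStar k 2 (g : L2) - (inner ℂ (zpow 0) (g : L2) : ℂ) • zpow 0) := by
    rw [coe_bshift, map_sub, map_smul, map_sub, map_smul, WStar_zmul, WStar_zpow, zmul_zpow,
      mul_neg_one, add_zero]
  generalize (inner ℂ (zpow 0) (g : L2) : ℂ) = c at *
  apply Lp.ext
  filter_upwards [coeFn_bmul (memLp_top_WStar (memLp_top_bshift hg) k) φ,
    coeFn_zmul (-k) (WStar k 2 (g : L2) - c • zpow 0),
    Lp.coeFn_sub (WStar k 2 (g : L2)) (c • zpow 0), Lp.coeFn_smul c (zpow 0), coeFn_zpow 0,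
    coeFn_zmul (-k) (bmul (memLp_top_WStar hg k) φ - c • φ),
    Lp.coeFn_sub (bmul (memLp_top_WStar hg k) φ) (c • φ), coeFn_bmul (memLp_top_WStar hg k) φ,
    Lp.coeFn_smul c φ] with x h1 h2 h3 h4 h5 h6 h7 h8 h9
  rw [h1, h0, h2, h3, h6, h7, Pi.sub_apply, Pi.sub_apply, h8, h9, h4, Pi.smul_apply, Pi.smul_apply, h5,
    fourier_zero, smul_eq_mul, smul_eq_mul]
  ring

theorem IsSlantCompression.inner_eq {k : ℕ} [NeZero k] {α β : InnerFn} {φ : L2}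
    {U : modelSpace α →L[ℂ] modelSpace β} (hU : IsSlantCompression k α β φ U) {f : modelSpace α}
    (hf : MemLp (f : L2) ∞ leb) {g : modelSpace β} (hg : MemLp (g : L2) ∞ leb) :
    (inner ℂ g (U f) : ℂ) = inner ℂ (bmul (memLp_top_WStar hg k) (star φ)) (f : L2) := by
  rw [hU f hf, slantCompression_eq, inner_proj_right, inner_W_right,
    inner_bmul_eq_inner_bmul_star hf (memLp_top_WStar hg k)]

theorem inner_star_zpow (φ : L2) (j : ℤ) :
    (inner ℂ (star φ) (zpow j) : ℂ) = inner ℂ (zpow 0) (zmul j φ) := by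
  rw [inner_zpow_zmul, ← inner_star_star, star_star, star_zpow, zero_sub]

/-- With $S_\beta$ moved onto $g$, the pairing involves $\bar z^k(f-\text{Taylor polynomial})$ and
$\bar z^k(g(z^k)-g(0))$. The unimodular factors cancel, and the product of the two differences is
expanded. -/
theorem IsSlantCompression.inner_cshift_bshift_pow {k : ℕ} [NeZero k] {α β : InnerFn} {φ : L2}
    {U : modelSpace α →L[ℂ] modelSpace β} (hU : IsSlantCompression k α β φ U) {f : modelSpace α}
    (hf : MemLp (f : L2) ∞ leb) {g : modelSpace β} (hg : MemLp (g : L2) ∞ leb) :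
    (inner ℂ g (cshift β (U ((bshift α ^ k) f))) : ℂ) =
      inner ℂ g (U f) - ∑ j ∈ Finset.range k, inner ℂ (zpow j) (f : L2) *
        (inner ℂ (g : L2) (W k (zmul j φ)) : ℂ) - inner ℂ (g : L2) (zpow 0) *
        (inner ℂ (star φ) (f : L2) - ∑ j ∈ Finset.range k, inner ℂ (zpow j) (f : L2) *
          (inner ℂ (zpow 0) (zmul j φ) : ℂ)) := by
  rw [← adjoint_inner_left, hU.inner_eq (memLp_top_bshift_pow hf k) (memLp_top_bshift hg),
    bmul_WStar_bshift k hg, coe_bshift_pow, inner_zmul, zmul_zmul, neg_neg, add_neg_cancel,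
    zmul_zero_apply, inner_sub_left, inner_smul_left, inner_sub_right, inner_sub_right,
    inner_sum, inner_sum, hU.inner_eq hf hg, inner_conj_symm]
  simp only [inner_smul_right, inner_bmul_star_zpow, inner_star_zpow, inner_W_right]

theorem IsSlantCompression.hasDisplacement {k : ℕ} [NeZero k] {α β : InnerFn} {φ : L2}
    {U : modelSpace α →L[ℂ] modelSpace β} (hU : IsSlantCompression k α β φ U) :
    HasDisplacement k U (proj α (star φ)) (fun j => (1 / (j.factorial : ℂ)) •
      (proj β (W k (zmul j φ)) - (inner ℂ (zpow 0) (zmul j φ) : ℂ) • kernel β 0)) := by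
  suffices h : U = cshift β ∘L U ∘L (bshift α ^ k) + rankOne ℂ (kernel β 0) (proj α (star φ)) +
      ∑ j ∈ Finset.range k, rankOne ℂ ((1 / (j.factorial : ℂ)) • (proj β (W k (zmul j φ)) -
        (inner ℂ (zpow 0) (zmul j φ) : ℂ) • kernel β 0)) (kernel α j) by
    intro f
    conv_lhs => rw [h]
    simp only [_root_.add_apply, comp_apply, _root_.sum_apply, rankOne_apply]
  -- Both sides are bounded operators, so bounded $f$ and $g$ suffice, and for these the pairings
  -- are integrals against the symbol.
  refine clm_ext_of_bounded fun f hf => eq_of_inner_bounded fun g hg => ?_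
  simp only [_root_.add_apply, comp_apply, rankOne_apply, _root_.sum_apply]
  rw [inner_add_right, inner_add_right, hU.inner_cshift_bshift_pow hf hg, inner_smul_coe,
    inner_proj_left, inner_kernel_zero_right, inner_sum]
  have h : ∀ j ∈ Finset.range k, (inner ℂ g ((inner ℂ (kernel α j) f : ℂ) •
      (1 / (j.factorial : ℂ)) • (proj β (W k (zmul j φ)) -
        (inner ℂ (zpow 0) (zmul j φ) : ℂ) • kernel β 0)) : ℂ) =
      inner ℂ (zpow j) (f : L2) * (inner ℂ (g : L2) (W k (zmul j φ)) : ℂ) -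
        inner ℂ (g : L2) (zpow 0) *
          (inner ℂ (zpow j) (f : L2) * (inner ℂ (zpow 0) (zmul j φ) : ℂ)) := by
    intro j _
    have h0 : (j.factorial : ℂ) ≠ 0 := by exact_mod_cast j.factorial_ne_zero
    rw [inner_smul_coe, inner_smul_coe, inner_sub_right, inner_smul_coe,
      inner_kernel_zero_right, inner_proj_right, inner_kernel_left]
    field_simp
  rw [Finset.sum_congr rfl h, Finset.sum_sub_distrib, ← Finset.mul_sum]
  ring

/-! ### Sufficiency: a displacement equation gives a symbol -/

theorem HasDisplacement.inner_eq {k : ℕ} [NeZero k] {α β : InnerFn} {U : modelSpace α →L[ℂ] modelSpace β}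
    {υ : modelSpace α} {τ : ℕ → modelSpace β} (h : HasDisplacement k U υ τ)
    (f : modelSpace α) (g : modelSpace β) (N : ℕ) : (inner ℂ g (U f) : ℂ) =
      inner ℂ ((bshift β ^ N) g) (U ((bshift α ^ (k * N)) f)) + ∑ n ∈ Finset.range N,
        ((inner ℂ (g : L2) (zpow n) : ℂ) * inner ℂ (zmul (k * n) (υ : L2)) (f : L2) +
        ∑ p ∈ Finset.range k, (p.factorial : ℂ) *
          ((inner ℂ (g : L2) (zmul n (τ p : L2)) : ℂ) *
            inner ℂ (zpow n) (W k (zmul (-p) (f : L2))))) := by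
  induction N with
  | zero => simp
  | succ N ih =>
    have h1 : (inner ℂ ((bshift β ^ N) g) (kernel β 0) : ℂ) = inner ℂ (g : L2) (zpow N) := by
      rw [inner_kernel_zero_right, ← inner_conj_symm]
      have := inner_zpow_bshift_pow N 0 g
      rw [Nat.cast_zero, add_zero] at this
      rw [this, inner_conj_symm]
    have h2 : ∀ x : modelSpace β, (inner ℂ ((bshift β ^ N) g) x : ℂ) =
        inner ℂ (g : L2) (zmul N (x : L2)) := fun x => by
      rw [← inner_conj_symm _ x, inner_bshift_pow_right N x g, inner_conj_symm]
    rw [ih, Finset.sum_range_succ, h ((bshift α ^ (k * N)) f), inner_add_right, inner_add_right,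
      inner_smul_coe, inner_sum, ← adjoint_inner_left, ← pow_succ_apply', h1,
      inner_bshift_pow_right]
    have h3 : (bshift α ^ k) ((bshift α ^ (k * N)) f) = (bshift α ^ (k * (N + 1))) f := by
      rw [mul_add_one, add_comm, pow_add]
      rfl
    have h4 : ∀ p ∈ Finset.range k, (inner ℂ ((bshift β ^ N) g)
        ((inner ℂ (kernel α p) ((bshift α ^ (k * N)) f) : ℂ) • τ p) : ℂ) =
        (p.factorial : ℂ) * ((inner ℂ (g : L2) (zmul N (τ p : L2)) : ℂ) *
            inner ℂ (zpow N) (W k (zmul (-p) (f : L2)))) := by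
      intro p _
      rw [inner_smul_coe, inner_kernel_left, inner_zpow_bshift_pow, inner_zpow_W,
        inner_zpow_zmul, h2, sub_neg_eq_add]
      push_cast
      ring
    rw [h3, Finset.sum_congr rfl h4]
    push_cast
    ring

theorem hasSum_inner_mul_inner_left {g : L2} (hg : g ∈ hardy) (v : L2) :
    HasSum (fun n : ℕ => (inner ℂ g (zpow n) : ℂ) * inner ℂ (zpow n) v) (inner ℂ g v) := by
  have h := ((hasSum_hardy hg).mapL (innerSL ℂ v)).map (starRingEnd ℂ) Complex.continuous_conj
  simpa only [Function.comp_def, innerSL_apply_apply, inner_smul_right, map_mul,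
    inner_conj_symm] using h

theorem hasSum_inner_mul_inner_right (g : L2) {v : L2} (hv : v ∈ hardy) :
    HasSum (fun n : ℕ => (inner ℂ g (zpow n) : ℂ) * inner ℂ (zpow n) v) (inner ℂ g v) := by
  have h := (hasSum_hardy hv).mapL (innerSL ℂ g)
  simpa only [innerSL_apply_apply, inner_smul_right, mul_comm] using h

/-- $W_k^*$ is composition with $z^k$, hence multiplicative, so the factor $W_k^*\tau$ can be
carried across $W_k$ and becomes $\bar\tau$ on $g$. -/
theorem inner_W_bmul_zmul_WStar {k : ℕ} [NeZero k] {f g : L2} (hf : MemLp f ∞ leb)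
    (hg : MemLp g ∞ leb) (τ : L2) (n : ℤ) :
    (inner ℂ g (W k (bmul hf (zmul n (WStar k 2 τ)))) : ℂ) =
      inner ℂ (bmul hg (star τ)) (W k (zmul n f)) := by
  rw [inner_W_right, inner_W_right, WStar_bmul_star, ← zmul_bmul, inner_zmul_right,
    inner_zmul_right]
  rw [L2.inner_def, L2.inner_def]
  apply integral_congr_ae
  filter_upwards [coeFn_zmul (-n) (WStar k 2 g), coeFn_bmul hf (WStar k 2 τ),
    coeFn_zmul (-n) (bmul (memLp_top_WStar hg k) (star (WStar k 2 τ))),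
    coeFn_bmul (memLp_top_WStar hg k) (star (WStar k 2 τ)), Lp.coeFn_star (WStar k 2 τ)]
    with x h1 h2 h3 h4 h5
  rw [h1, h2, h3, h4, h5]
  simp only [RCLike.inner_apply, Pi.star_apply, map_mul, RCLike.star_def, Complex.conj_conj]
  ring

theorem HasDisplacement.isSlantCompression {k : ℕ} [NeZero k] {α β : InnerFn}
    {U : modelSpace α →L[ℂ] modelSpace β} {υ : modelSpace α} {τ : ℕ → modelSpace β}
    (h : HasDisplacement k U υ τ) :
    IsSlantCompression k α β (star (υ : L2) + ∑ p ∈ Finset.range k, (p.factorial : ℂ) •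
      zmul (-p) (WStar k 2 (τ p : L2))) U := by
  intro f hf
  refine eq_of_inner_bounded fun g hg => ?_
  -- Here $W_k(f\bar\upsilon)$ need not be analytic, so the one-sided Parseval expansion relies on
  -- $g\in H^2$; for the $\tau_p$ terms below, $g\bar\tau_p$ need not be analytic and the other
  -- factor must be.
  have h1 : HasSum (fun n : ℕ => (inner ℂ (g : L2) (zpow n) : ℂ) *
      inner ℂ (zmul (k * n) (υ : L2)) (f : L2))
      (inner ℂ (g : L2) (W k (bmul hf (star (υ : L2))))) := by
    have h := hasSum_inner_mul_inner_left (coe_mem_hardy g) (W k (bmul hf (star (υ : L2))))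
    simpa only [inner_zpow_W, ← inner_zmul_eq_inner_bmul_star] using h
  have h2 : ∀ p ∈ Finset.range k, HasSum (fun n : ℕ => (p.factorial : ℂ) *
      ((inner ℂ (g : L2) (zmul n (τ p : L2)) : ℂ) *
        inner ℂ (zpow n) (W k (zmul (-p) (f : L2)))))
      ((p.factorial : ℂ) * inner ℂ (g : L2) (W k (bmul hf (zmul (-p) (WStar k 2 (τ p : L2)))))) := by
    intro p hp
    -- Since $p<k$, the index $kn+p$ is negative for every $n\le-1$, so $\bar z^p$ creates no
    -- negative frequency that survives $W_k$.
    have hW : W k (zmul (-p) (f : L2)) ∈ hardy := by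
      rw [mem_hardy_iff]
      intro n hn
      rw [inner_zpow_W, inner_zpow_zmul, (mem_hardy_iff _).mp (coe_mem_hardy f)]
      have := Finset.mem_range.mp hp
      nlinarith
    rw [inner_W_bmul_zmul_WStar hf hg]
    refine HasSum.mul_left _ ?_
    simpa only [inner_bmul_star_zpow] using
      hasSum_inner_mul_inner_right (bmul hg (star (τ p : L2))) hW
  have h3 := (h1.add (hasSum_sum h2)).tendsto_sum_nat
  -- The remainder after $N$ iterations: both backward shifts tend to zero strongly.
  have h4 : Tendsto (fun N : ℕ =>
      (inner ℂ ((bshift β ^ N) g) (U ((bshift α ^ (k * N)) f)) : ℂ)) atTop (𝓝 0) := by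
    have h5 := (tendsto_bshift_pow f).comp (tendsto_id.const_mul_atTop' (NeZero.pos k))
    have h6 := (tendsto_bshift_pow g).inner (𝕜 := ℂ) ((U.continuous.tendsto 0).comp h5)
    simpa using h6
  have h7 := h4.add h3
  replace h7 := h7.congr fun N => (h.inner_eq f g N).symm
  rw [tendsto_nhds_unique tendsto_const_nhds h7, slantCompression_eq, inner_proj_right, map_add,
    map_sum, map_add, map_sum, inner_add_right, inner_sum, zero_add]
  simp only [map_smul, inner_smul_right]

/-! ### Conjugate kernels -/

theorem coeFn_toL2 (u : Linf) : ⇑u.toL2 =ᵐ[leb] u :=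
  ((Lp.memLp u).mono_exponent le_top).coeFn_toLp

theorem star_smul_L2 (c : ℂ) (f : L2) : star (c • f) = (starRingEnd ℂ) c • star f := by
  apply Lp.ext
  filter_upwards [Lp.coeFn_star (c • f), Lp.coeFn_smul c f, Lp.coeFn_star f,
    Lp.coeFn_smul ((starRingEnd ℂ) c) (star f)] with x h1 h2 h3 h4
  rw [h1, h4, Pi.star_apply, h2, Pi.smul_apply, Pi.smul_apply, h3, Pi.star_apply]
  simp

theorem star_add_L2 (f g : L2) : star (f + g) = star f + star g := by
  apply Lp.ext
  filter_upwards [Lp.coeFn_star (f + g), Lp.coeFn_add f g, Lp.coeFn_star f, Lp.coeFn_star g,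
    Lp.coeFn_add (star f) (star g)] with x h1 h2 h3 h4 h5
  rw [h1, h5, Pi.star_apply, h2, Pi.add_apply, Pi.add_apply, h3, h4, star_add]
  rfl

theorem star_sub_L2 (f g : L2) : star (f - g) = star f - star g := by
  rw [eq_sub_iff_add_eq, ← star_add_L2, sub_add_cancel]

theorem star_sum_L2 {ι : Type*} (s : Finset ι) (f : ι → L2) :
    star (∑ i ∈ s, f i) = ∑ i ∈ s, star (f i) :=
  map_sum (AddMonoidHom.mk' (star : L2 → L2) star_add_L2) f s

theorem conjC_smul (α : InnerFn) (c : ℂ) (f : L2) :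
    conjC α (c • f) = (starRingEnd ℂ) c • conjC α f := by
  rw [conjC, star_smul_L2, map_smul, map_smul, conjC]

theorem coeFn_conjC (α : InnerFn) (f : L2) :
    ⇑(conjC α f) =ᵐ[leb] fun x => α.toLinf x * (fourier (-1) x * (starRingEnd ℂ) (f x)) := by
  filter_upwards [coeFn_mulL2 α.toLinf (zmul (-1) (star f)), coeFn_zmul_star f] with x h1 h2
  rw [conjC, h1, h2]
  rfl

theorem mul_conj_toLinf (α : InnerFn) :
    ∀ᵐ x ∂leb, α.toLinf x * (starRingEnd ℂ) (α.toLinf x) = 1 := by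
  filter_upwards [α.norm_eq_one] with x h
  rw [Complex.mul_conj, Complex.normSq_eq_norm_sq, h]
  simp

theorem conjC_sub_smul (α : InnerFn) (n : ℤ) (c : ℂ) (f : L2) :
    conjC α (zmul n f - c • α.toLinf.toL2) =
      zmul (-n) (conjC α f) - (starRingEnd ℂ) c • zpow (-1) := by
  apply Lp.ext
  filter_upwards [coeFn_conjC α (zmul n f - c • α.toLinf.toL2),
    Lp.coeFn_sub (zmul n f) (c • α.toLinf.toL2), coeFn_zmul n f,
    Lp.coeFn_smul c α.toLinf.toL2, coeFn_toL2 α.toLinf,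
    Lp.coeFn_sub (zmul (-n) (conjC α f)) ((starRingEnd ℂ) c • zpow (-1)),
    coeFn_zmul (-n) (conjC α f), coeFn_conjC α f, Lp.coeFn_smul ((starRingEnd ℂ) c) (zpow (-1)),
    coeFn_zpow (-1), mul_conj_toLinf α] with x h1 h2 h3 h4 h5 h6 h7 h8 h9 h10 h11
  rw [h1, h2, h6, Pi.sub_apply, Pi.sub_apply, h3, h4, h7, h8, h9, Pi.smul_apply, Pi.smul_apply,
    h5, h10]
  simp only [smul_eq_mul, map_sub, map_mul, fourier_neg]
  linear_combination (-(starRingEnd ℂ) c * (starRingEnd ℂ) (fourier 1 x)) * h11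

theorem conjC_zpow_zero (α : InnerFn) : conjC α (zpow 0) = zmul (-1) α.toLinf.toL2 := by
  rw [conjC, star_zpow, neg_zero, mulL2_zmul, mulL2_toLinf_zpow_zero]

theorem coe_conjKernel_zero (α : InnerFn) : (conjKernel α 0 : L2) =
    zmul (-1) α.toLinf.toL2 - (inner ℂ (zpow 0) α.toLinf.toL2 : ℂ) • zpow (-1) := by
  change conjC α (kernel α 0 : L2) = _
  rw [coe_kernel_zero, ← zmul_zero_apply (zpow 0), conjC_sub_smul, neg_zero, zmul_zero_apply,
    zmul_zero_apply, conjC_zpow_zero, inner_conj_symm]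

theorem inner_zpow_zero_conjC (α : InnerFn) (f : L2) :
    (inner ℂ (zpow 0) (conjC α f) : ℂ) = inner ℂ (zmul 1 f) α.toLinf.toL2 := by
  rw [L2.inner_def, L2.inner_def]
  apply integral_congr_ae
  filter_upwards [coeFn_zpow 0, coeFn_conjC α f, coeFn_zmul 1 f, coeFn_toL2 α.toLinf]
    with x h1 h2 h3 h4
  rw [h1, h2, h3, h4]
  simp only [RCLike.inner_apply, map_mul, fourier_neg, fourier_zero, map_one]
  ring

/-- The intertwining $C_\alpha S_\alpha=S_\alpha^*C_\alpha$: conjugation turns $z$ into $\bar z$,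
and $\alpha\bar\alpha=1$ turns the multiple of $\alpha$ into one of $\bar z$. It makes the conjugate
kernels an orbit of $S_\alpha^*$. -/
theorem conjC_cshift {α : InnerFn} (f : modelSpace α) :
    conjC α (cshift α f) = (bshift α ⟨conjC α f, conjC_mem α f.2⟩ : modelSpace α) := by
  rw [coe_cshift, conjC_sub_smul, coe_bshift, inner_zpow_zero_conjC, inner_conj_symm]

theorem conjKernel_eq_smul (α : InnerFn) (n : ℕ) :
    conjKernel α n = (n.factorial : ℂ) • (bshift α ^ n) (conjKernel α 0) := by
  induction n with
  | zero => simp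
  | succ n ih =>
    have h1 : kernel α (n + 1) = ((n + 1 : ℕ) : ℂ) • cshift α (kernel α n) := by
      rw [kernel_eq_smul, kernel_eq_smul α n, map_smul, smul_smul, pow_succ_apply',
        Nat.factorial_succ, Nat.cast_mul]
    have h2 : conjKernel α (n + 1) = ((n + 1 : ℕ) : ℂ) • bshift α (conjKernel α n) := by
      refine Subtype.ext ?_
      change conjC α (kernel α (n + 1) : L2) = _
      rw [h1, Submodule.coe_smul, conjC_smul, conjC_cshift, map_natCast]
      rfl
    rw [h2, ih, map_smul, smul_smul, pow_succ_apply', Nat.factorial_succ, Nat.cast_mul]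

/-- The rank-one defect comes from the multiple of $\alpha$ subtracted in $S_\alpha f$: applying
$S_\alpha^*$ leaves $\bar z(\alpha-\alpha(0))=\widetilde k_0^\alpha$. -/
theorem bshift_cshift {α : InnerFn} (f : modelSpace α) :
    bshift α (cshift α f) = f - (inner ℂ (conjKernel α 0) f : ℂ) • conjKernel α 0 := by
  have h0 : (inner ℂ (zpow 0) (zmul 1 (f : L2)) : ℂ) = 0 := by
    rw [inner_zpow_zmul, (mem_hardy_iff _).mp (coe_mem_hardy f) _ (by omega)]
  have h1 : (inner ℂ (conjKernel α 0) f : ℂ) = inner ℂ α.toLinf.toL2 (zmul 1 (f : L2)) := by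
    rw [Submodule.coe_inner, coe_conjKernel_zero, inner_sub_left, inner_smul_left,
      (mem_hardy_iff _).mp (coe_mem_hardy f) (-1) (by omega), mul_zero, sub_zero, inner_zmul,
      neg_neg]
  refine Subtype.ext ?_
  rw [Submodule.coe_sub, Submodule.coe_smul, coe_conjKernel_zero, coe_bshift, coe_cshift, h1,
    inner_sub_right, h0, inner_smul_right, map_sub, map_smul, zmul_zmul, neg_add_cancel,
    zmul_zero_apply]
  module

/-- The rank-one defect telescopes along the powers. The factor $(1/j!)^2$ undoes the $j!$ in each
of the two copies of $\widetilde k_{0,j}^\alpha=j!\,(S_\alpha^*)^j\widetilde k_0^\alpha$. -/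
theorem bshift_pow_cshift_pow {α : InnerFn} (m : ℕ) (f : modelSpace α) :
    (bshift α ^ m) ((cshift α ^ m) f) = f - ∑ j ∈ Finset.range m,
      ((1 / (j.factorial : ℂ)) ^ 2 * inner ℂ (conjKernel α j) f) • conjKernel α j := by
  induction m with
  | zero => simp
  | succ m ih =>
    have h0 : (m.factorial : ℂ) ≠ 0 := by exact_mod_cast m.factorial_ne_zero
    have h1 : (bshift α ^ (m + 1)) ((cshift α ^ (m + 1)) f) =
        (bshift α ^ m) (bshift α (cshift α ((cshift α ^ m) f))) := by
      rw [pow_succ, pow_succ_apply']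
      rfl
    have h2 : (inner ℂ (conjKernel α m) f : ℂ) =
        m.factorial * inner ℂ (conjKernel α 0) ((cshift α ^ m) f) := by
      rw [← adjoint_inner_left (cshift α ^ m), adjoint_pow_cshift, conjKernel_eq_smul,
        inner_smul_coe_left, Complex.conj_natCast]
    rw [h1, bshift_cshift, map_sub, map_smul, ih, Finset.sum_range_succ, h2,
      conjKernel_eq_smul α m, smul_smul, sub_sub]
    congr 3
    field_simp

/-! ### Symbols of the form `conj φ₋ + φ₊` -/

theorem inner_zpow_eq_zero_of_mem_map {u : Linf} {φ : L2}
    (h : φ ∈ (modelSpaceOf u).map (zmul 1 : L2 →ₗ[ℂ] L2)) {n : ℤ} (hn : n ≤ 0) :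
    (inner ℂ (zpow n) φ : ℂ) = 0 := by
  obtain ⟨f, hf, rfl⟩ := h
  change (inner ℂ (zpow n) (zmul 1 f) : ℂ) = 0
  rw [inner_zpow_zmul, (mem_hardy_iff _).mp hf.1 _ (by omega)]

/-- For a symbol split into $\bar\psi_-$ and $\psi_+$, the general displacement data simplify:
$\psi_+$ does not contribute to $\upsilon$, and $\psi_-$ does not contribute to the $\tau_j$. -/
theorem IsSlantCompression.hasDisplacement_lowerPart {k : ℕ} [NeZero k] {α β : InnerFn}
    {ψneg : modelSpace α} {ψpos : L2} (hψ : ∀ n : ℤ, n ≤ 0 → (inner ℂ (zpow n) ψpos : ℂ) = 0)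
    {U : modelSpace α →L[ℂ] modelSpace β}
    (hU : IsSlantCompression k α β (star (ψneg : L2) + ψpos) U) :
    HasDisplacement k U ψneg (fun j => (1 / (j.factorial : ℂ)) • lowerPart k β ψpos j) := by
  have hυ : proj α (star (star (ψneg : L2) + ψpos)) = ψneg := by
    rw [star_add_L2, star_star, map_add, proj_coe, proj_eq_zero_of_coeff, add_zero]
    intro n
    rw [inner_zpow_star, ← inner_conj_symm, hψ _ (by omega), map_zero]
  have hτ : ∀ j ∈ Finset.range k, proj β (W k (zmul j (star (ψneg : L2) + ψpos))) -
      (inner ℂ (zpow 0) (zmul j (star (ψneg : L2) + ψpos)) : ℂ) • kernel β 0 =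
      lowerPart k β ψpos j := by
    intro j hj
    have hj' := Finset.mem_range.mp hj
    -- The frequencies of $z^j\bar\psi_-$ are at most $j<k$, so the only nonnegative one surviving
    -- $W_k$ is $0$; its contribution is the multiple of $k_0^\beta$ being subtracted.
    have h1 : proj β (W k (zmul j (star (ψneg : L2)))) =
        (inner ℂ (zpow 0) (zmul j (star (ψneg : L2))) : ℂ) • kernel β 0 := by
      rw [kernel, Nat.factorial_zero, Nat.cast_one, one_smul, Nat.cast_zero, ← map_smul,
        ← sub_eq_zero, ← map_sub]
      refine proj_eq_zero_of_coeff β fun n => ?_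
      rw [inner_sub_right, inner_zpow_W, inner_smul_right, inner_zpow]
      rcases Nat.eq_zero_or_pos n with rfl | hn
      · simp
      · rw [if_neg (by omega), mul_zero, sub_zero, inner_zpow_zmul, inner_zpow_star,
          ← inner_conj_symm, (mem_hardy_iff _).mp (coe_mem_hardy ψneg), map_zero]
        have : (k : ℤ) * 1 ≤ k * n := by gcongr; omega
        omega
    have h2 : (inner ℂ (zpow 0) (zmul j ψpos) : ℂ) = 0 := by
      rw [inner_zpow_zmul, hψ _ (by omega)]
    -- This coefficient is the $(-j)$-th one of $\psi_+$. Its vanishing lets $S_\beta P_\beta$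
    -- become $P_\beta z$, and $zW_k\bar z^{k-j}=W_kz^j$.
    have h3 : (inner ℂ (zpow (-1)) (W k (zmul (j - k) ψpos)) : ℂ) = 0 := by
      rw [inner_zpow_W, inner_zpow_zmul, hψ _ (by omega)]
    rw [lowerPart, cshift_proj, h3, zero_smul, sub_zero, zmul_W, zmul_zmul, map_add, map_add,
      map_add, inner_add_right, h1, h2, add_zero, add_sub_cancel_left]
    congr 3
    ring_nf
  intro f
  have h := hU.hasDisplacement f
  rw [hυ] at h
  rw [h]
  congr 1
  refine Finset.sum_congr rfl fun j hj => ?_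
  simp only [hτ j hj]

theorem HasDisplacement.iterate {k : ℕ} {α β : InnerFn} {U : modelSpace α →L[ℂ] modelSpace β}
    {υ : modelSpace α} {τ : ℕ → modelSpace β} (h : HasDisplacement k U υ τ) (m : ℕ)
    (f : modelSpace α) :
    U f = (cshift β ^ m) (U ((bshift α ^ (k * m)) f)) + ∑ n ∈ Finset.range m,
      ((inner ℂ ((cshift α ^ (k * n)) υ) f : ℂ) • (cshift β ^ n) (kernel β 0) +
        ∑ l ∈ Finset.range k,
          (inner ℂ ((cshift α ^ (k * n)) (kernel α l)) f : ℂ) • (cshift β ^ n) (τ l)) := by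
  induction m with
  | zero => simp
  | succ m ih =>
    have h1 : (bshift α ^ k) ((bshift α ^ (k * m)) f) = (bshift α ^ (k * (m + 1))) f := by
      rw [mul_add_one, add_comm, pow_add]
      rfl
    have h2 : ∀ x : modelSpace β, (cshift β ^ m) (cshift β x) = (cshift β ^ (m + 1)) x :=
      fun x => by rw [pow_succ]; rfl
    have h3 : ∀ x : modelSpace α, (inner ℂ x ((bshift α ^ (k * m)) f) : ℂ) =
        inner ℂ ((cshift α ^ (k * m)) x) f := fun x => by
      rw [← adjoint_inner_right (cshift α ^ (k * m)), adjoint_pow_cshift]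
    conv_lhs => rw [ih, h ((bshift α ^ (k * m)) f)]
    rw [h1, Finset.sum_range_succ, map_add, map_add, map_sum, h2, map_smul]
    simp only [map_smul, h3]
    abel

/-! ### The product of two compressions: displacement and symbol -/

theorem sum_range_sum_range {M : Type*} [AddCommMonoid M] (k m : ℕ) (f : ℕ → M) :
    ∑ n ∈ Finset.range m, ∑ l ∈ Finset.range k, f (k * n + l) =
      ∑ p ∈ Finset.range (k * m), f p := by
  induction m with
  | zero => simp
  | succ m ih => rw [Finset.sum_range_succ, ih, mul_add_one, Finset.sum_range_add]

variable {k m : ℕ} [NeZero k] {α β γ : InnerFn}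

/-- The element of `K_α` whose conjugate is the explicit co-analytic part of `productSymbol`. -/
noncomputable def productNeg (k m : ℕ) [NeZero k] (B : modelSpace α →L[ℂ] modelSpace β)
    (φneg : modelSpace β) (ψneg : modelSpace α) (ψpos : L2) : modelSpace α :=
  adjoint B φneg
    - ∑ n ∈ Finset.range m, (starRingEnd ℂ) (inner ℂ φneg ((cshift β ^ n) (kernel β 0)) : ℂ) •
        (cshift α ^ (k * n)) ψneg
    - ∑ n ∈ Finset.range m, ∑ l ∈ Finset.range k,
        (starRingEnd ℂ) ((1 / (l.factorial : ℂ)) *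
          inner ℂ φneg ((cshift β ^ n) (lowerPart k β ψpos l))) •
          (cshift α ^ (k * n)) (kernel α l)

/-- `A F_{n,l} - ∑ⱼ 1/j! ⟨F_{n,l}, k_{0,j}^β⟩ G_j`. -/
noncomputable def productPos (k m : ℕ) [NeZero k] [NeZero m]
    (A : modelSpace β →L[ℂ] modelSpace γ) (φpos ψpos : L2) (n l : ℕ) : modelSpace γ :=
  A ((cshift β ^ n) (lowerPart k β ψpos l)) - ∑ j ∈ Finset.range m,
    ((1 / (j.factorial : ℂ)) * inner ℂ (kernel β j) ((cshift β ^ n) (lowerPart k β ψpos l))) •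
      lowerPart m γ φpos j

/-- The coefficient `1/p! (A F_{n,l} - ∑ⱼ 1/j! ⟨F_{n,l}, k_{0,j}^β⟩ G_j)`, `p = kn + l`, `l < k`, of
`k_{0,p}^α`. -/
noncomputable def productCoeff (k m : ℕ) [NeZero k] [NeZero m]
    (A : modelSpace β →L[ℂ] modelSpace γ) (φpos ψpos : L2) (p : ℕ) : modelSpace γ :=
  (1 / (p.factorial : ℂ)) • productPos k m A φpos ψpos (p / k) (p % k)

/-- The left-hand side of `ProductCondition`. -/
noncomputable def productLHS (k m : ℕ) [NeZero k] [NeZero m]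
    (A : modelSpace β →L[ℂ] modelSpace γ) (B : modelSpace α →L[ℂ] modelSpace β)
    (φpos : L2) (ψneg : modelSpace α) : modelSpace α →L[ℂ] modelSpace γ :=
  ∑ n ∈ Finset.range m, (1 / (n.factorial : ℂ)) •
      rankOne ℂ (A (kernel β n)) ((cshift α ^ (k * n)) ψneg)
    - ∑ j ∈ Finset.range m, (1 / (j.factorial : ℂ)) ^ 2 •
      rankOne ℂ (cshift γ (A (conjKernel β j)))
        ((cshift α ^ (k * m)) (adjoint B (conjKernel β j)))
    + ∑ j ∈ Finset.range m, (1 / (j.factorial : ℂ)) •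
      rankOne ℂ (lowerPart m γ φpos j)
        (adjoint B (kernel β j) - ∑ n ∈ Finset.range m,
          (starRingEnd ℂ) (inner ℂ (kernel β j) ((cshift β ^ n) (kernel β 0))) •
            (cshift α ^ (k * n)) ψneg)

theorem inner_productNeg (B : modelSpace α →L[ℂ] modelSpace β)
    (φneg : modelSpace β) (ψneg : modelSpace α) (ψpos : L2) (f : modelSpace α) :
    (inner ℂ (productNeg k m B φneg ψneg ψpos) f : ℂ) = inner ℂ φneg (B f)
    - ∑ n ∈ Finset.range m, (inner ℂ φneg ((cshift β ^ n) (kernel β 0)) : ℂ) *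
        inner ℂ ((cshift α ^ (k * n)) ψneg) f
    - ∑ n ∈ Finset.range m, ∑ l ∈ Finset.range k, (1 / (l.factorial : ℂ)) *
          inner ℂ φneg ((cshift β ^ n) (lowerPart k β ψpos l)) *
          (inner ℂ ((cshift α ^ (k * n)) (kernel α l)) f : ℂ) := by
  simp only [productNeg, inner_sub_left, sum_inner, inner_smul_coe_left, Complex.conj_conj,
    adjoint_inner_left]

variable [NeZero m]

theorem productLHS_apply (A : modelSpace β →L[ℂ] modelSpace γ)
    (B : modelSpace α →L[ℂ] modelSpace β) (φpos : L2) (ψneg : modelSpace α) (f : modelSpace α) :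
    productLHS k m A B φpos ψneg f =
      ∑ n ∈ Finset.range m, ((1 / (n.factorial : ℂ)) *
        inner ℂ ((cshift α ^ (k * n)) ψneg) f) • A (kernel β n)
    - ∑ j ∈ Finset.range m, ((1 / (j.factorial : ℂ)) ^ 2 *
        inner ℂ (conjKernel β j) (B ((bshift α ^ (k * m)) f))) • cshift γ (A (conjKernel β j))
    + ∑ j ∈ Finset.range m, ((1 / (j.factorial : ℂ)) * (inner ℂ (kernel β j) (B f) -
        ∑ n ∈ Finset.range m, inner ℂ (kernel β j) ((cshift β ^ n) (kernel β 0)) *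
          (inner ℂ ((cshift α ^ (k * n)) ψneg) f : ℂ))) • lowerPart m γ φpos j := by
  have h : ∀ x : modelSpace α, (inner ℂ ((cshift α ^ (k * m)) x) f : ℂ) =
      inner ℂ x ((bshift α ^ (k * m)) f) := fun x => by
    rw [← adjoint_inner_right (cshift α ^ (k * m)), adjoint_pow_cshift]
  simp only [productLHS, _root_.add_apply, _root_.sub_apply, _root_.sum_apply, _root_.smul_apply,
    rankOne_apply, smul_smul, h, adjoint_inner_left, inner_sub_left, sum_inner,
    inner_smul_coe_left, Complex.conj_conj]

/-- Division with remainder $p=kn+l$ matches the two sums, because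
$S_\alpha^{kn}k_{0,l}^\alpha=\frac{l!}{(kn+l)!}k_{0,kn+l}^\alpha$. -/
theorem sum_productCoeff (A : modelSpace β →L[ℂ] modelSpace γ) (φpos ψpos : L2)
    (f : modelSpace α) :
    ∑ p ∈ Finset.range (k * m), (inner ℂ (kernel α p) f : ℂ) • productCoeff k m A φpos ψpos p =
      ∑ n ∈ Finset.range m, ∑ l ∈ Finset.range k, ((1 / (l.factorial : ℂ)) *
        inner ℂ ((cshift α ^ (k * n)) (kernel α l)) f) • productPos k m A φpos ψpos n l := by
  rw [← sum_range_sum_range]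
  refine Finset.sum_congr rfl fun n _ => Finset.sum_congr rfl fun l hl => ?_
  have hl' := Finset.mem_range.mp hl
  have h0 : (l.factorial : ℂ) ≠ 0 := by exact_mod_cast l.factorial_ne_zero
  have h1 : ((k * n + l).factorial : ℂ) ≠ 0 := by exact_mod_cast (k * n + l).factorial_ne_zero
  rw [productCoeff, Nat.mul_add_div (NeZero.pos k), Nat.div_eq_of_lt hl', Nat.mul_add_mod,
    Nat.mod_eq_of_lt hl', add_zero, smul_smul, cshift_pow_kernel, inner_smul_coe_left]
  congr 1
  simp only [map_div₀, map_natCast]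
  field_simp

/-- $B$ has to be iterated $m$ times because the equation of $A$ involves $(S_\beta^*)^m$, which
must meet $S_\beta^m$; this also produces the exponent $km$ on the side of $\alpha$. -/
theorem comp_eq_productLHS_add {A : modelSpace β →L[ℂ] modelSpace γ}
    {B : modelSpace α →L[ℂ] modelSpace β} {φneg : modelSpace β} {φpos : L2}
    {ψneg : modelSpace α} {ψpos : L2}
    (hA : HasDisplacement m A φneg (fun j => (1 / (j.factorial : ℂ)) • lowerPart m γ φpos j))
    (hB : HasDisplacement k B ψneg (fun l => (1 / (l.factorial : ℂ)) • lowerPart k β ψpos l))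
    (f : modelSpace α) :
    A (B f) = cshift γ (A (B ((bshift α ^ (k * m)) f))) + productLHS k m A B φpos ψneg f +
      (inner ℂ (productNeg k m B φneg ψneg ψpos) f : ℂ) • kernel γ 0 +
      ∑ p ∈ Finset.range (k * m), (inner ℂ (kernel α p) f : ℂ) •
        productCoeff k m A φpos ψpos p := by
  -- The equation of $A$ solved for its shifted term. It is used at $x=Bf$ and again at each vector
  -- produced by iterating $B$.
  have hΦ : ∀ x, cshift γ (A ((bshift β ^ m) x)) = A x - (inner ℂ φneg x : ℂ) • kernel γ 0 -
      ∑ j ∈ Finset.range m, ((1 / (j.factorial : ℂ)) * inner ℂ (kernel β j) x) •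
        lowerPart m γ φpos j := by
    intro x
    rw [hA x]
    simp only [smul_smul, mul_comm]
    abel
  have h1 : cshift γ (A ((bshift β ^ m) (B f))) =
      cshift γ (A (B ((bshift α ^ (k * m)) f))) - ∑ j ∈ Finset.range m,
        ((1 / (j.factorial : ℂ)) ^ 2 * inner ℂ (conjKernel β j) (B ((bshift α ^ (k * m)) f))) •
          cshift γ (A (conjKernel β j)) + ∑ n ∈ Finset.range m,
      ((inner ℂ ((cshift α ^ (k * n)) ψneg) f : ℂ) •
          cshift γ (A ((bshift β ^ m) ((cshift β ^ n) (kernel β 0)))) +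
        ∑ l ∈ Finset.range k, ((1 / (l.factorial : ℂ)) *
          inner ℂ ((cshift α ^ (k * n)) (kernel α l)) f) •
          cshift γ (A ((bshift β ^ m) ((cshift β ^ n) (lowerPart k β ψpos l))))) := by
    conv_lhs => rw [hB.iterate m f]
    simp only [map_add, map_sum, map_smul, bshift_pow_cshift_pow, map_sub, smul_smul, mul_comm]
  have h2 : ∀ n, A ((cshift β ^ n) (kernel β 0)) = (1 / (n.factorial : ℂ)) • A (kernel β n) := by
    intro n
    rw [cshift_pow_kernel, map_smul, add_zero, Nat.factorial_zero, Nat.cast_one]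
  have h3 : ∀ n l, cshift γ (A ((bshift β ^ m) ((cshift β ^ n) (lowerPart k β ψpos l)))) =
      productPos k m A φpos ψpos n l -
        (inner ℂ φneg ((cshift β ^ n) (lowerPart k β ψpos l)) : ℂ) • kernel γ 0 := by
    intro n l
    rw [hΦ, productPos]
    abel
  have h4 := hΦ (B f)
  rw [h1] at h4
  simp only [h3] at h4
  simp only [hΦ, h2] at h4
  rw [productLHS_apply, inner_productNeg, sum_productCoeff]
  -- Interchanging the sums over $j$ and $n$ brings the $G_j$ terms to the shape given by `hΦ` at
  -- $S_\beta^nk_0^\beta$.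
  have h5 : ∑ j ∈ Finset.range m, ((1 / (j.factorial : ℂ)) * (inner ℂ (kernel β j) (B f) -
        ∑ n ∈ Finset.range m, inner ℂ (kernel β j) ((cshift β ^ n) (kernel β 0)) *
          (inner ℂ ((cshift α ^ (k * n)) ψneg) f : ℂ))) • lowerPart m γ φpos j =
      ∑ j ∈ Finset.range m, ((1 / (j.factorial : ℂ)) * inner ℂ (kernel β j) (B f)) •
        lowerPart m γ φpos j - ∑ n ∈ Finset.range m, ∑ j ∈ Finset.range m,
        ((inner ℂ ((cshift α ^ (k * n)) ψneg) f : ℂ) * ((1 / (j.factorial : ℂ)) *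
          inner ℂ (kernel β j) ((cshift β ^ n) (kernel β 0)))) • lowerPart m γ φpos j := by
    rw [Finset.sum_comm, ← Finset.sum_sub_distrib]
    refine Finset.sum_congr rfl fun j _ => ?_
    rw [← Finset.sum_smul, ← sub_smul, mul_sub, Finset.mul_sum]
    congr 2
    refine Finset.sum_congr rfl fun n _ => ?_
    ring
  rw [h5]
  simp only [smul_sub, smul_smul, Finset.sum_add_distrib, Finset.sum_sub_distrib, sub_smul,
    Finset.smul_sum, Finset.sum_smul] at h4 ⊢
  rw [eq_comm, sub_eq_iff_eq_add, sub_eq_iff_eq_add] at h4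
  have e1 : ∀ n : ℕ, (inner ℂ ((cshift α ^ (k * n)) ψneg) f : ℂ) * (1 / (n.factorial : ℂ)) =
      1 / (n.factorial : ℂ) * inner ℂ ((cshift α ^ (k * n)) ψneg) f := fun n => mul_comm _ _
  have e2 : ∀ n : ℕ, (inner ℂ ((cshift α ^ (k * n)) ψneg) f : ℂ) *
      inner ℂ φneg ((cshift β ^ n) (kernel β 0)) = inner ℂ φneg ((cshift β ^ n) (kernel β 0)) *
        (inner ℂ ((cshift α ^ (k * n)) ψneg) f : ℂ) := fun n => mul_comm _ _
  have e3 : ∀ n l : ℕ, 1 / (l.factorial : ℂ) * inner ℂ ((cshift α ^ (k * n)) (kernel α l)) f *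
      inner ℂ φneg ((cshift β ^ n) (lowerPart k β ψpos l)) = 1 / (l.factorial : ℂ) *
        inner ℂ φneg ((cshift β ^ n) (lowerPart k β ψpos l)) *
          inner ℂ ((cshift α ^ (k * n)) (kernel α l)) f := fun n l => mul_right_comm _ _ _
  rw [h4]
  simp only [e1, e2, e3]
  abel

/-- The product condition says that `A B` satisfies a displacement equation with shifted data. -/
theorem hasDisplacement_comp_iff {A : modelSpace β →L[ℂ] modelSpace γ}
    {B : modelSpace α →L[ℂ] modelSpace β} {φneg : modelSpace β} {φpos : L2}
    {ψneg : modelSpace α} {ψpos : L2}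
    (hA : HasDisplacement m A φneg (fun j => (1 / (j.factorial : ℂ)) • lowerPart m γ φpos j))
    (hB : HasDisplacement k B ψneg (fun l => (1 / (l.factorial : ℂ)) • lowerPart k β ψpos l))
    (υ : modelSpace α) (τ : ℕ → modelSpace γ) :
    HasDisplacement (k * m) (A ∘L B) (υ + productNeg k m B φneg ψneg ψpos)
      (fun p => τ p + productCoeff k m A φpos ψpos p) ↔
    ProductCondition k m A B φpos ψneg υ (fun p => τ p) := by
  have h1 : ProductCondition k m A B φpos ψneg υ (fun p => τ p) ↔ ∀ f,
      productLHS k m A B φpos ψneg f = (inner ℂ υ f : ℂ) • kernel γ 0 +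
        ∑ p ∈ Finset.range (k * m), (inner ℂ (kernel α p) f : ℂ) • τ p := by
    change productLHS k m A B φpos ψneg = _ ↔ _
    rw [ContinuousLinearMap.ext_iff]
    refine forall_congr' fun f => ?_
    simp only [_root_.add_apply, _root_.sum_apply, rankOne_apply]
    rw [Finset.sum_range]
  rw [h1]
  refine forall_congr' fun f => ?_
  simp only [comp_apply]
  rw [comp_eq_productLHS_add hA hB f, inner_add_left, add_smul]
  simp only [smul_add, Finset.sum_add_distrib]
  constructor <;> intro h
  · rw [← sub_eq_zero] at h ⊢
    rw [← h]
    abel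
  · rw [h]
    abel

/-- Identifies $\xi$ with the symbol that `HasDisplacement.isSlantCompression` assigns to the
shifted data; the $p!$ there cancels the $1/p!$ in `productCoeff`. -/
theorem productSymbol_eq (A : modelSpace β →L[ℂ] modelSpace γ)
    (B : modelSpace α →L[ℂ] modelSpace β) (φneg : modelSpace β) (φpos : L2)
    (ψneg : modelSpace α) (ψpos : L2) (υ : modelSpace α) (τ : ℕ → modelSpace γ) :
    productSymbol k m A B φneg φpos ψneg ψpos υ (fun p => τ p) =
      star ((υ + productNeg k m B φneg ψneg ψpos : modelSpace α) : L2) +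
        ∑ p ∈ Finset.range (k * m), (p.factorial : ℂ) • zmul (-p)
          (WStar (k * m) 2 ((τ p + productCoeff k m A φpos ψpos p : modelSpace γ) : L2)) := by
  have h1 : ∑ p ∈ Finset.range (k * m), (p.factorial : ℂ) • zmul (-p)
        (WStar (k * m) 2 (productCoeff k m A φpos ψpos p : L2)) =
      ∑ n ∈ Finset.range m, ∑ l ∈ Finset.range k, zmul (-((k * n + l : ℕ) : ℤ))
        (WStar (k * m) 2 (productPos k m A φpos ψpos n l : L2)) := by
    rw [← sum_range_sum_range]
    refine Finset.sum_congr rfl fun n _ => Finset.sum_congr rfl fun l hl => ?_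
    have hl' := Finset.mem_range.mp hl
    have h1 : ((k * n + l).factorial : ℂ) ≠ 0 := by exact_mod_cast (k * n + l).factorial_ne_zero
    rw [productCoeff, Nat.mul_add_div (NeZero.pos k), Nat.div_eq_of_lt hl', Nat.mul_add_mod,
      Nat.mod_eq_of_lt hl', add_zero, Submodule.coe_smul, map_smul, map_smul, smul_smul,
      mul_one_div_cancel h1, one_smul]
  simp only [Submodule.coe_add, map_add, smul_add, Finset.sum_add_distrib]
  rw [h1, productSymbol, Finset.sum_range
    (fun p : ℕ => (p.factorial : ℂ) • zmul (-p) (WStar (k * m) 2 (τ p : L2)))]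
  simp only [productPos, productNeg, star_add_L2, star_sub_L2, star_sum_L2, star_smul_L2,
    Submodule.coe_sub, Submodule.coe_sum, Submodule.coe_smul, Complex.conj_conj]
  abel

end SlantToeplitz

theorem mainTheorem5 (α β γ : InnerFn)
    (hα : α.Nonconstant) (hβ : β.Nonconstant) (hγ : γ.Nonconstant)
    (k m : ℕ) [NeZero k] [NeZero m]
    (hk : (k : Cardinal) ≤ Module.rank ℂ (modelSpace α))
    (hm : (m : Cardinal) ≤ Module.rank ℂ (modelSpace β))
    (φneg : modelSpace β) (φpos : L2)
    (hφ : φpos ∈ (modelSpaceOf (WStar m ⊤ γ.toLinf)).map (zmul 1 : L2 →ₗ[ℂ] L2))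
    (ψneg : modelSpace α) (ψpos : L2)
    (hψ : ψpos ∈ (modelSpaceOf (WStar k ⊤ β.toLinf)).map (zmul 1 : L2 →ₗ[ℂ] L2))
    (A : modelSpace β →L[ℂ] modelSpace γ)
    (hA : IsSlantCompression m β γ (star (φneg : L2) + φpos) A)
    (B : modelSpace α →L[ℂ] modelSpace β)
    (hB : IsSlantCompression k α β (star (ψneg : L2) + ψpos) B) :
    (A ∘L B ∈ slantClass (k * m) α γ ↔
      ∃ (υ : modelSpace α) (τ : Fin (k * m) → modelSpace γ),
        ProductCondition k m A B φpos ψneg υ τ) ∧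
    ∀ (υ : modelSpace α) (τ : Fin (k * m) → modelSpace γ),
      ProductCondition k m A B φpos ψneg υ τ →
      IsSlantCompression (k * m) α γ (productSymbol k m A B φneg φpos ψneg ψpos υ τ) (A ∘L B) := by
  have hA' := hA.hasDisplacement_lowerPart fun n hn => inner_zpow_eq_zero_of_mem_map hφ hn
  have hB' := hB.hasDisplacement_lowerPart fun n hn => inner_zpow_eq_zero_of_mem_map hψ hn
  have hsymbol : ∀ (υ : modelSpace α) (τ : Fin (k * m) → modelSpace γ),
      ProductCondition k m A B φpos ψneg υ τ →
      IsSlantCompression (k * m) α γ (productSymbol k m A B φneg φpos ψneg ψpos υ τ)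
        (A ∘L B) := by
    intro υ τ h
    -- The finite family is extended by zero, since displacement data are indexed by all of $\mathbb
    -- N$; only indices below $km$ matter.
    obtain ⟨σ, rfl⟩ : ∃ σ : ℕ → modelSpace γ, τ = fun p : Fin (k * m) => σ p :=
      ⟨fun p => if hp : p < k * m then τ ⟨p, hp⟩ else 0, by ext1 p; simp⟩
    rw [productSymbol_eq]
    exact ((hasDisplacement_comp_iff hA' hB' υ σ).mpr h).isSlantCompression
  refine ⟨⟨?_, fun ⟨υ, τ, h⟩ => ⟨_, hsymbol υ τ h⟩⟩, hsymbol⟩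
  rintro ⟨ξ, hξ⟩
  -- The witnesses are the displacement data of $AB=U_\xi$ with the explicit shift subtracted.
  refine ⟨proj α (star ξ) - productNeg k m B φneg ψneg ψpos, _,
    (hasDisplacement_comp_iff hA' hB' _ (fun p => (1 / (p.factorial : ℂ)) •
      (proj γ (W (k * m) (zmul p ξ)) - (inner ℂ (zpow 0) (zmul p ξ) : ℂ) • kernel γ 0) -
        productCoeff k m A φpos ψpos p)).mp ?_⟩
  simpa only [sub_add_cancel] using hξ.hasDisplacement
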